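/- Setting. Let $\mathcal T\ge 1$ be the number of periods and $k$ the dimension of the covariates. For a population individual let $Y_t(0),Y_t(1)$ ($t=1,\dots,\mathcal T$) be real potential outcomes without and with treatment, $X\in\mathbb R^k$ covariates and $D_t\in\{0,1\}$ treatment indicators; the observed outcome is $Y_t=D_tY_t(1)+(1-D_t)Y_t(0)$. Let $G_g=1$ if the individual is first treated in period $g$ and $G_g=0$ otherwise, and let $C=1$ if the individual is never treated and $C=0$ otherwise. Put $\mathcal W=(Y_1,\dots,Y_{\mathcal T},X,G_1,\dots,G_{\mathcal T},C)$. For $2\le g\le t\le\mathcal T$ let $ATT(g,t)=\mathbb E[Y_t(1)-Y_t(0)\mid G_g=1]$, and let $p_g(X)=P(G_g=1\mid X,\,G_g+C=1)$. The expectations defining the $ATT(g,t)$ are assumed to exist. Assumptions. 1. (Sampling) The observed vectors $(Y_{i1},\dots,Y_{i\mathcal T},X_i,D_{i1},\dots,D_{i\mathcal T})$, $i=1,\dots,n$, are independent copies of the observed vector $(Y_1,\dots,Y_{\mathcal T},X,D_1,\dots,D_{\mathcal T})$. 2. (Conditional parallel trends) For all $2\le g\le t\le\mathcal T$, $\mathbb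 E[Y_t(0)-Y_{t-1}(0)\mid X,G_g=1]=\mathbb E[Y_t(0)-Y_{t-1}(0)\mid X,C=1]$ a.s. 3. (Irreversibility) For $t=2,\dots,\mathcal T$, $D_{t-1}=1$ implies $D_t=1$. 4. (Overlap) For all $g=2,\dots,\mathcal T$, $P(G_g=1)>0$, and $p_g(X)<1-\varepsilon$ a.s. for some $\varepsilon>0$. 5. (Parametric propensity score) For all $g=2,\dots,\mathcal T$: (i) there is a known function $\Lambda_g:\mathbb R\to[0,1]$ with $p_g(X)=\Lambda_g(X'\pi_g^0)$; (ii) $\pi_g^0\in\operatorname{int}(\Pi_g)$, where $\Pi_g\subset\mathbb R^k$ is compact; (iii) the support $\mathcal X$ of $X$ is contained in a compact set, and $\mathbb E[XX'\mid G_g+C=1]$ is positive definite; (iv) with $\mathcal U_g=\{x'\pi:x\in\mathcal X,\ \pi\in\Pi_g\}$, for each $u\in\mathcal U_g$ there is $\varepsilon>0$ with $\Lambda_g(u)\in[\varepsilon,1-\varepsilon]$, and on $\mathcal U_g$ the function $\Lambda_g$ is strictly increasing and twice continuously differentiable (that is, $\Lambda_g$ is $C^2$ in a neighbourhood of each $u\in\mathcal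 U_g$), with first derivative bounded away from zero and infinity and bounded second derivative; (v) $\mathbb E[Y_t^2]<\infty$ for $t=1,\dots,\mathcal T$. Estimators. For each $g=2,\dots,\mathcal T$ let $\hat\pi_g$ be a maximum likelihood estimator, i.e. a (measurable) maximizer over $\pi\in\Pi_g$ of $$\sum_{i:\,G_{ig}+C_i=1}\Big[G_{ig}\ln\Lambda_g(X_i'\pi)+(1-G_{ig})\ln\big(1-\Lambda_g(X_i'\pi)\big)\Big],$$ and let $\hat p_g(x)=\Lambda_g(x'\hat\pi_g)$. With $\mathbb E_n[Z]=n^{-1}\sum_{i=1}^nZ_i$, let $$\widehat{ATT}(g,t)=\mathbb E_n\left[\left(\frac{G_g}{\mathbb E_n[G_g]}-\frac{\frac{\hat p_g(X)C}{1-\hat p_g(X)}}{\mathbb E_n\Big[\frac{\hat p_g(X)C}{1-\hat p_g(X)}\Big]}\right)(Y_t-Y_{g-1})\right].$$ Influence functions. Let $\dot p_g(X)=\Lambda_g'(X'\pi_g^0)$, $$w_g^G=\frac{G_g}{\mathbb E[G_g]},\qquad w_g^C=\frac{p_g(X)C}{1-p_g(X)}\Big/\mathbb E\left[\frac{p_g(X)C}{1-p_g(X)}\right],$$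 $$\xi_g^\pi(\mathcal W)=\mathbb E\left[\frac{(G_g+C)\,\dot p_g(X)^2}{p_g(X)(1-p_g(X))}XX'\right]^{-1}X\,\frac{(G_g+C)(G_g-p_g(X))\,\dot p_g(X)}{p_g(X)(1-p_g(X))},$$ $$M_{gt}=\frac{\mathbb E\left[X\left(\frac{C}{1-p_g(X)}\right)^2\dot p_g(X)\Big(Y_t-Y_{g-1}-\mathbb E[w_g^C(Y_t-Y_{g-1})]\Big)\right]}{\mathbb E\left[\frac{p_g(X)C}{1-p_g(X)}\right]},$$ and $\psi_{gt}=\psi_{gt}^G-\psi_{gt}^C$, where $$\psi_{gt}^G(\mathcal W)=w_g^G\Big[(Y_t-Y_{g-1})-\mathbb E[w_g^G(Y_t-Y_{g-1})]\Big],$$ $$\psi_{gt}^C(\mathcal W)=w_g^C\Big[(Y_t-Y_{g-1})-\mathbb E[w_g^C(Y_t-Y_{g-1})]\Big]+M_{gt}'\,\xi_g^\pi(\mathcal W).$$ Let $\widehat{ATT}_{g\le t}$, $ATT_{g\le t}$ and $\Psi_{g\le t}$ be the vectors that stack $\widehat{ATT}(g,t)$, $ATT(g,t)$ and $\psi_{gt}$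 over all $2\le g\le t\le\mathcal T$. Theorem. Under Assumptions 1–5, for all $2\le g\le t\le\mathcal T$, $\psi_{gt}(\mathcal W)$ is square integrable and, as $n\to\infty$, $$\sqrt n\big(\widehat{ATT}(g,t)-ATT(g,t)\big)=\frac1{\sqrt n}\sum_{i=1}^n\psi_{gt}(\mathcal W_i)+o_p(1).$$ Furthermore, $$\sqrt n\big(\widehat{ATT}_{g\le t}-ATT_{g\le t}\big)\xrightarrow{d}N(0,\Sigma),\qquad \Sigma=\mathbb E\big[\Psi_{g\le t}(\mathcal W)\Psi_{g\le t}(\mathcal W)'\big].$$ -/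

import Mathlib

open MeasureTheory ProbabilityTheory Filter Topology
open scoped Matrix

namespace DiD

noncomputable section

/-! ### Observables -/

/-- The time periods `1, …, T`. -/
abbrev Period (T : ℕ) : Type := {t : ℕ // t ∈ Finset.Icc 1 T}

/-- The preceding period; it is only used for periods `t ≥ 2`, where it is `t - 1`. -/
def prev {T : ℕ} (t : Period T) : Period T :=
  if h : 2 ≤ (t : ℕ) then
    ⟨(t : ℕ) - 1, by have := Finset.mem_Icc.1 t.2; exact Finset.mem_Icc.2 (by omega)⟩
  else t

/-- One observation: the outcomes `Y_1, …, Y_T`, the covariate vector `X ∈ ℝᵏ` and the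
treatment indicators `D_1, …, D_T` (`true` means treated). -/
abbrev Obs (T k : ℕ) : Type := (Period T → ℝ) × (Fin k → ℝ) × (Period T → Bool)

/-- Outcome `Y_t`. -/
def outcome {T k : ℕ} (t : Period T) (w : Obs T k) : ℝ := w.1 t

/-- Covariates `X`. -/
def covar {T k : ℕ} (w : Obs T k) : Fin k → ℝ := w.2.1

/-- Treatment indicator `D_t`. -/
def treat {T k : ℕ} (t : Period T) (w : Obs T k) : Bool := w.2.2 t

open Classical in
/-- `G_g`: one if the individual is first treated in period `g`, zero otherwise. -/
def G {T k : ℕ} (g : Period T) (w : Obs T k) : ℝ :=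
  if treat g w = true ∧ ∀ s, s < g → treat s w = false then 1 else 0

open Classical in
/-- `C`: one if the individual is never treated, zero otherwise. -/
def C {T k : ℕ} (w : Obs T k) : ℝ :=
  if ∀ s, treat s w = false then 1 else 0

/-- The long difference `Y_t - Y_{g-1}`. -/
def longDiff {T k : ℕ} (g t : Period T) (w : Obs T k) : ℝ :=
  outcome t w - outcome (prev g) w

/-! ### The population -/

/-- A population individual, as random variables on `Ω`: the untreated and treated potential
outcomes `Y_t(0)`, `Y_t(1)`, the covariates `X` and the binary treatment indicators `D_t`. -/
structure Population (T k : ℕ) (Ω : Type*) [MeasurableSpace Ω] where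
  Y0 : Period T → Ω → ℝ
  Y1 : Period T → Ω → ℝ
  X : Ω → Fin k → ℝ
  D : Period T → Ω → Bool
  measurable_Y0 : ∀ t, Measurable (Y0 t)
  measurable_Y1 : ∀ t, Measurable (Y1 t)
  measurable_X : Measurable X
  measurable_D : ∀ t, Measurable (D t)

namespace Population

variable {T k : ℕ} {Ω : Type*} [MeasurableSpace Ω]

/-- The observed outcome `Y_t = D_t Y_t(1) + (1 - D_t) Y_t(0)`. -/
def Y (pop : Population T k Ω) (t : Period T) (ω : Ω) : ℝ :=
  if pop.D t ω = true then pop.Y1 t ω else pop.Y0 t ω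

/-- The observed vector `(Y_1, …, Y_T, X, D_1, …, D_T)`. -/
def obs (pop : Population T k Ω) (ω : Ω) : Obs T k :=
  (fun t => pop.Y t ω, pop.X ω, fun t => pop.D t ω)

/-- The law of the observed vector. -/
def law (pop : Population T k Ω) (P : Measure Ω) : Measure (Obs T k) := P.map pop.obs

/-- The event `G_g = 1`. -/
def evG (pop : Population T k Ω) (g : Period T) : Set Ω := {ω | G g (pop.obs ω) = 1}

/-- The event `C = 1`. -/
def evC (pop : Population T k Ω) : Set Ω := {ω | C (pop.obs ω) = 1}

/-- The event `G_g + C = 1`. -/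
def evGC (pop : Population T k Ω) (g : Period T) : Set Ω :=
  {ω | G g (pop.obs ω) + C (pop.obs ω) = 1}

/-- The σ-algebra generated by the covariates. -/
abbrev sigmaX (pop : Population T k Ω) : MeasurableSpace Ω :=
  MeasurableSpace.comap pop.X inferInstance

/-- The group-time average treatment effect `ATT(g,t) = E[Y_t(1) - Y_t(0) | G_g = 1]`. -/
def ATT (pop : Population T k Ω) (P : Measure Ω) (g t : Period T) : ℝ :=
  ∫ ω, (pop.Y1 t ω - pop.Y0 t ω) ∂(ProbabilityTheory.cond P (pop.evG g))

/-- The expectations defining `ATT(g,t)`, `2 ≤ g ≤ t ≤ T`, exist. -/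
def ExpectationsExist (pop : Population T k Ω) (P : Measure Ω) : Prop :=
  ∀ g t : Period T, 2 ≤ (g : ℕ) → g ≤ t →
    Integrable (fun ω => pop.Y1 t ω - pop.Y0 t ω) (ProbabilityTheory.cond P (pop.evG g))

/-- The generalized propensity score `p_g(X) = P(G_g = 1 | X, G_g + C = 1)`: the conditional
probability of `G_g = 1` given `X`, under the population law conditioned on `G_g + C = 1`
(hence determined up to null sets of that conditioned law). -/
def pscore (pop : Population T k Ω) (P : Measure Ω) (g : Period T) : Ω → ℝ :=
  condExp pop.sigmaX (ProbabilityTheory.cond P (pop.evGC g)) (fun ω => G g (pop.obs ω))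

/-- Conditional parallel trends:
`E[Y_t(0) - Y_{t-1}(0) | X, G_g = 1] = E[Y_t(0) - Y_{t-1}(0) | X, C = 1]` a.s., `2 ≤ g ≤ t`. -/
def ParallelTrends (pop : Population T k Ω) (P : Measure Ω) : Prop :=
  ∀ g t : Period T, 2 ≤ (g : ℕ) → g ≤ t →
    condExp pop.sigmaX (ProbabilityTheory.cond P (pop.evG g))
        (fun ω => pop.Y0 t ω - pop.Y0 (prev t) ω)
      =ᵐ[ProbabilityTheory.cond P (pop.evG g)]
    condExp pop.sigmaX (ProbabilityTheory.cond P pop.evC)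
        (fun ω => pop.Y0 t ω - pop.Y0 (prev t) ω)

/-- Irreversibility of treatment. -/
def Irreversible (pop : Population T k Ω) (P : Measure Ω) : Prop :=
  ∀ t : Period T, 2 ≤ (t : ℕ) → ∀ᵐ ω ∂P, pop.D (prev t) ω = true → pop.D t ω = true

/-- Overlap: `P(G_g = 1) > 0`, and `p_g(X) < 1 - ε` a.s. for some `ε > 0`. -/
def Overlap (pop : Population T k Ω) (P : Measure Ω) : Prop :=
  ∀ g : Period T, 2 ≤ (g : ℕ) →
    0 < P (pop.evG g) ∧
    ∃ ε : ℝ, 0 < ε ∧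
      ∀ᵐ ω ∂(ProbabilityTheory.cond P (pop.evGC g)), pop.pscore P g ω < 1 - ε

/-- The set `{x'π : x ∈ supp X, π ∈ Θ}` of values of the linear index. -/
def indexSet (pop : Population T k Ω) (P : Measure Ω) (Θ : Set (Fin k → ℝ)) : Set ℝ :=
  {u | ∃ x ∈ (P.map pop.X).support, ∃ π ∈ Θ, u = x ⬝ᵥ π}

/-- The parametric propensity score model of group `g`, with link `Λ`, compact parameter set `Θ`
and true parameter `π₀`. -/
structure PScoreModel (pop : Population T k Ω) (P : Measure Ω) (g : Period T)
    (Λ : ℝ → ℝ) (Θ : Set (Fin k → ℝ)) (π₀ : Fin k → ℝ) : Prop where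
  range : ∀ u, Λ u ∈ Set.Icc (0 : ℝ) 1
  correct : pop.pscore P g =ᵐ[ProbabilityTheory.cond P (pop.evGC g)]
    fun ω => Λ (pop.X ω ⬝ᵥ π₀)
  compact : IsCompact Θ
  interior : π₀ ∈ interior Θ
  support : ∃ S : Set (Fin k → ℝ), IsCompact S ∧ (P.map pop.X).support ⊆ S
  posDef : (Matrix.of fun a b =>
    ∫ ω, pop.X ω a * pop.X ω b ∂(ProbabilityTheory.cond P (pop.evGC g))).PosDef
  bounds : ∀ u ∈ pop.indexSet P Θ, ∃ ε : ℝ, 0 < ε ∧ Λ u ∈ Set.Icc ε (1 - ε)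
  strictMono : StrictMonoOn Λ (pop.indexSet P Θ)
  smooth : ∀ u ∈ pop.indexSet P Θ, ContDiffAt ℝ 2 Λ u
  deriv_bounds : ∃ c M : ℝ, 0 < c ∧ ∀ u ∈ pop.indexSet P Θ, c ≤ deriv Λ u ∧ deriv Λ u ≤ M
  deriv2_bound : ∃ M : ℝ, ∀ u ∈ pop.indexSet P Θ, |iteratedDeriv 2 Λ u| ≤ M

end Population

/-! ### Estimation -/

section Estimation

variable {T k : ℕ}

/-- The control weight `p(X) C / (1 - p(X))` with `p(x) = Λ(x'π)`. -/
def ctrlWeight (Λ : ℝ → ℝ) (π : Fin k → ℝ) (w : Obs T k) : ℝ :=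
  Λ (covar w ⬝ᵥ π) * C w / (1 - Λ (covar w ⬝ᵥ π))

open Classical in
/-- The log-likelihood of the sample `w_0, …, w_{n-1}`, over the observations with
`G_g + C = 1`. -/
def logLik (g : Period T) (Λ : ℝ → ℝ) (n : ℕ) (w : ℕ → Obs T k) (π : Fin k → ℝ) : ℝ :=
  ∑ i ∈ (Finset.range n).filter (fun i => G g (w i) + C (w i) = 1),
    (G g (w i) * Real.log (Λ (covar (w i) ⬝ᵥ π))
      + (1 - G g (w i)) * Real.log (1 - Λ (covar (w i) ⬝ᵥ π)))

/-- `π` maximizes the log-likelihood over the parameter set `Θ`. -/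
def IsMLE (g : Period T) (Λ : ℝ → ℝ) (Θ : Set (Fin k → ℝ)) (n : ℕ) (w : ℕ → Obs T k)
    (π : Fin k → ℝ) : Prop :=
  π ∈ Θ ∧ ∀ π' ∈ Θ, logLik g Λ n w π' ≤ logLik g Λ n w π

/-- The sample mean `E_n[f] = n⁻¹ ∑ f(w_i)`. -/
def sampleMean (n : ℕ) (w : ℕ → Obs T k) (f : Obs T k → ℝ) : ℝ :=
  (n : ℝ)⁻¹ * ∑ i ∈ Finset.range n, f (w i)

/-- The estimator of `ATT(g,t)` from the sample `w_0, …, w_{n-1}`, with fitted propensity score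
`x ↦ Λ(x'π)`. -/
def attHat (g t : Period T) (Λ : ℝ → ℝ) (π : Fin k → ℝ) (n : ℕ) (w : ℕ → Obs T k) : ℝ :=
  sampleMean n w fun v =>
    (G g v / sampleMean n w (G g)
      - ctrlWeight Λ π v / sampleMean n w (ctrlWeight Λ π)) * longDiff g t v

end Estimation

/-! ### Influence functions

Below `μ` is the law of the observed vector, and `p(x) = Λ(x'π)`, `ṗ(x) = Λ'(x'π)`, with `π` the
true parameter. -/

section Influence

variable {T k : ℕ}

/-- The normalized weight `w_g^G`. -/
def wG (μ : Measure (Obs T k)) (g : Period T) (w : Obs T k) : ℝ :=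
  G g w / ∫ v, G g v ∂μ

/-- The normalized weight `w_g^C`. -/
def wC (μ : Measure (Obs T k)) (Λ : ℝ → ℝ) (π : Fin k → ℝ) (w : Obs T k) : ℝ :=
  ctrlWeight Λ π w / ∫ v, ctrlWeight Λ π v ∂μ

/-- The matrix `E[(G_g + C) ṗ(X)² / (p(X) (1 - p(X))) X X']`. -/
def infoMatrix (μ : Measure (Obs T k)) (g : Period T) (Λ : ℝ → ℝ) (π : Fin k → ℝ) :
    Matrix (Fin k) (Fin k) ℝ :=
  Matrix.of fun a b => ∫ w,
    (G g w + C w) * deriv Λ (covar w ⬝ᵥ π) ^ 2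
      / (Λ (covar w ⬝ᵥ π) * (1 - Λ (covar w ⬝ᵥ π))) * (covar w a * covar w b) ∂μ

/-- The influence function `ξ_g^π` of the maximum likelihood estimator. -/
def xi (μ : Measure (Obs T k)) (g : Period T) (Λ : ℝ → ℝ) (π : Fin k → ℝ) (w : Obs T k) :
    Fin k → ℝ :=
  (infoMatrix μ g Λ π)⁻¹ *ᵥ
    (((G g w + C w) * (G g w - Λ (covar w ⬝ᵥ π)) * deriv Λ (covar w ⬝ᵥ π)
      / (Λ (covar w ⬝ᵥ π) * (1 - Λ (covar w ⬝ᵥ π)))) • covar w)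

/-- `E[w_g^C (Y_t - Y_{g-1})]`. -/
def meanC (μ : Measure (Obs T k)) (g t : Period T) (Λ : ℝ → ℝ) (π : Fin k → ℝ) : ℝ :=
  ∫ w, wC μ Λ π w * longDiff g t w ∂μ

/-- The vector `M_gt`. -/
def Mvec (μ : Measure (Obs T k)) (g t : Period T) (Λ : ℝ → ℝ) (π : Fin k → ℝ) : Fin k → ℝ :=
  fun a =>
    (∫ w, covar w a * (C w / (1 - Λ (covar w ⬝ᵥ π))) ^ 2 * deriv Λ (covar w ⬝ᵥ π)
        * (longDiff g t w - meanC μ g t Λ π) ∂μ)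
      / ∫ w, ctrlWeight Λ π w ∂μ

/-- `ψ_gt^G`. -/
def psiG (μ : Measure (Obs T k)) (g t : Period T) (w : Obs T k) : ℝ :=
  wG μ g w * (longDiff g t w - ∫ v, wG μ g v * longDiff g t v ∂μ)

/-- `ψ_gt^C`, including the correction for the estimated propensity score. -/
def psiC (μ : Measure (Obs T k)) (g t : Period T) (Λ : ℝ → ℝ) (π : Fin k → ℝ)
    (w : Obs T k) : ℝ :=
  wC μ Λ π w * (longDiff g t w - meanC μ g t Λ π) + Mvec μ g t Λ π ⬝ᵥ xi μ g Λ π w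

/-- The influence function `ψ_gt = ψ_gt^G - ψ_gt^C`. -/
def psi (μ : Measure (Obs T k)) (g t : Period T) (Λ : ℝ → ℝ) (π : Fin k → ℝ)
    (w : Obs T k) : ℝ :=
  psiG μ g t w - psiC μ g t Λ π w

/-- The pairs `(g,t)` with `2 ≤ g ≤ t ≤ T`. -/
abbrev GT (T : ℕ) : Type := {q : Period T × Period T // 2 ≤ (q.1 : ℕ) ∧ q.1 ≤ q.2}

/-- The matrix `Σ = E[Ψ Ψ']`, where `Ψ` stacks the `ψ_gt` over `2 ≤ g ≤ t ≤ T`. -/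
def Sigma (μ : Measure (Obs T k)) (Λ : Period T → ℝ → ℝ) (π : Period T → Fin k → ℝ) :
    Matrix (GT T) (GT T) ℝ :=
  Matrix.of fun q r => ∫ w,
    psi μ q.1.1 q.1.2 (Λ q.1.1) (π q.1.1) w * psi μ r.1.1 r.1.2 (Λ r.1.1) (π r.1.1) w ∂μ

end Influence

end

end DiD

/-! The theorem joins an identification argument and an asymptotic expansion.

Identification (`estimand_eq_ATT`). Let p be the propensity score and ρ = p/(1-p) the odds. If m(X)
is the conditional mean of a trend in Y(0), common to group g and to the never treated, then E[G m]
= E[(G+C) p m], while E[C ρ m] = E[(G+C)(1-p) ρ m], and these agree because (1-p)ρ = p. So the odds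
carry the trends of the never treated over to group g. Parallel trends give this one period at a
time; summing the periods from g to t gives the long difference from g-1 to t. By irreversibility
group g reveals Y_t(1), so the difference of the two weighted means is ATT(g,t).

Expansion (`remainder_le`). Only the properties collected in `BinaryResponse` matter. A strong law
in the Banach space of continuous functions gives uniform laws over the parameter set; with Gibbs'
inequality the maximum likelihood estimator is strongly consistent. Smooth functions of the index
are expanded around the true parameter by divided differences, so every expansion is an exact
identity. The likelihood equations become s_n + A_n(πhat - π₀) = 0, where s_n is the mean score at
π₀ and A_n tends almost surely to minus the information matrix; hence πhat - π₀ = -A_n⁻¹ s_n for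
large n. Substituting this in the estimator, the error of the linear approximation is a sum of
products (coefficient tending to 0 almost surely) × (sample mean of a centred square integrable
function). No separate rate for πhat is needed.

Conclusion. After multiplication by √n those means are bounded in L¹ by a variance computation, so
`tendstoInMeasure_zero_of_small_mul` makes the error o_p(1). The influence functions are centred and
square integrable, so `IIDSample.centralLimit` and a Slutsky argument give the joint normal limit.
-/

namespace DiD

noncomputable section

/-! ### Samples -/

/-- `W` is an i.i.d. sample from the law `μ`. -/
structure IIDSample {α Ω' : Type*} [MeasurableSpace α] [MeasurableSpace Ω']
    (W : ℕ → Ω' → α) (Q : Measure Ω') (μ : Measure α) : Prop where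
  aemeasurable : ∀ i, AEMeasurable (W i) Q
  map_eq : ∀ i, Q.map (W i) = μ
  indep : iIndepFun W Q

/-! ### Laws of large numbers, uniform laws and moment bounds for i.i.d. samples. -/

namespace IIDSample

variable {α Ω' : Type*} [MeasurableSpace α] [MeasurableSpace Ω']
  {W : ℕ → Ω' → α} {Q : Measure Ω'} {μ : Measure α}

lemma ae_forall (h : IIDSample W Q μ) {p : α → Prop} (hp : ∀ᵐ w ∂μ, p w) :
    ∀ᵐ ω ∂Q, ∀ i, p (W i ω) := by
  rw [ae_all_iff]
  intro i
  rw [← h.map_eq i] at hp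
  exact ae_of_ae_map (h.aemeasurable i) hp

lemma identDistrib (h : IIDSample W Q μ) {E : Type*} [MeasurableSpace E] {f : α → E}
    (hf : AEMeasurable f μ) (i : ℕ) :
    IdentDistrib (fun ω => f (W i ω)) f Q μ where
  aemeasurable_fst := by
    rw [← h.map_eq i] at hf
    exact hf.comp_aemeasurable (h.aemeasurable i)
  aemeasurable_snd := hf
  map_eq := by
    have hf' := hf
    rw [← h.map_eq i] at hf'
    rw [← h.map_eq i, AEMeasurable.map_map_of_aemeasurable hf' (h.aemeasurable i)]
    rfl

lemma iIndepFun_comp (h : IIDSample W Q μ) {E : Type*} [MeasurableSpace E] {f : α → E}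
    (hf : AEMeasurable f μ) : iIndepFun (fun i ω => f (W i ω)) Q :=
  h.indep.comp₀ (fun _ => f) h.aemeasurable (fun i => by rwa [h.map_eq i])

/-- Strong law of large numbers in a Banach space. -/
lemma strongLaw (h : IIDSample W Q μ) {E : Type*} [NormedAddCommGroup E] [NormedSpace ℝ E]
    [CompleteSpace E] [MeasurableSpace E] [BorelSpace E] {f : α → E} (hf : Integrable f μ) :
    ∀ᵐ ω ∂Q, Tendsto (fun n : ℕ => (n : ℝ)⁻¹ • ∑ i ∈ Finset.range n, f (W i ω)) atTop
      (𝓝 (∫ w, f w ∂μ)) := by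
  have hi := h.identDistrib hf.aemeasurable
  rw [← (hi 0).integral_eq]
  refine strong_law_ae (fun i ω => f (W i ω)) ((hi 0).integrable_iff.2 hf) ?_
    (fun i => (hi i).trans (hi 0).symm)
  exact fun i j hij => (h.iIndepFun_comp hf.aemeasurable).indepFun hij

open Classical in
/-- Uniform strong law for averages of `a(w) b(x(w), π)` with `b` continuous on a compact set. -/
lemma uniformLaw (h : IIDSample W Q μ) {V : Type*} [MetricSpace V] [MeasurableSpace V]
    [BorelSpace V] {a : α → ℝ} (ha : Integrable a μ) {x : α → V} (hx : Measurable x)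
    {S K : Set V} (hS : IsCompact S) (hK : IsCompact K) (hxS : ∀ᵐ w ∂μ, x w ∈ S)
    {b : V → V → ℝ} (hb : ContinuousOn (Function.uncurry b) (S ×ˢ K)) :
    ∀ᵐ ω ∂Q, TendstoUniformlyOn
      (fun (n : ℕ) π => (n : ℝ)⁻¹ * ∑ i ∈ Finset.range n, a (W i ω) * b (x (W i ω)) π)
      (fun π => ∫ w, a w * b (x w) π ∂μ) atTop K := by
  -- Uniform convergence on `K` is norm convergence in `C(K, ℝ)`, so the claim is the Banach-space
  -- strong law for the random function `a(w) • b(x(w), ·)`, read off by evaluation at each point.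
  have : CompactSpace K := isCompact_iff_compactSpace.1 hK
  have : CompactSpace S := isCompact_iff_compactSpace.1 hS
  let _ : MeasurableSpace C(K, ℝ) := borel _
  have : BorelSpace C(K, ℝ) := ⟨rfl⟩
  let bc : C(S × K, ℝ) := ⟨fun p => b p.1 p.2, by
    refine hb.comp_continuous (f := fun p : S × K => ((p.1 : V), (p.2 : V))) (by fun_prop) ?_
    exact fun p => ⟨p.1.2, p.2.2⟩⟩
  let B : C(S, C(K, ℝ)) := bc.curry
  have hSm : MeasurableSet S := hS.measurableSet
  -- Since `x w` lies in `S` only almost everywhere, the continuous map from `S` to `C(K, ℝ)` is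
  -- extended by zero to a bounded measurable map on all of `V`.
  let F0 : V → C(K, ℝ) := fun v => if hv : v ∈ S then B ⟨v, hv⟩ else 0
  have hF0 : Measurable F0 := by
    refine Measurable.dite (f := fun v : S => B v) (g := fun _ => (0 : C(K, ℝ))) ?_ ?_ hSm
    · exact B.continuous.measurable
    · exact measurable_const
  obtain ⟨M, hM⟩ : ∃ M, ∀ v, ‖F0 v‖ ≤ M := by
    refine ⟨‖B‖, fun v => ?_⟩
    by_cases hv : v ∈ S
    · simpa [F0, hv] using B.norm_coe_le_norm ⟨v, hv⟩
    · simp only [F0, hv, dif_neg, not_false_eq_true, norm_zero]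
      exact norm_nonneg B
  let F : α → C(K, ℝ) := fun w => a w • F0 (x w)
  have hF0s : AEStronglyMeasurable (fun w => F0 (x w)) μ :=
    (hF0.comp hx).aestronglyMeasurable
  have hF : Integrable F μ := by
    refine Integrable.mono' (ha.norm.mul_const M) (ha.1.smul hF0s) (ae_of_all _ fun w => ?_)
    rw [norm_smul]
    exact mul_le_mul_of_nonneg_left (hM _) (norm_nonneg _)
  have hev : ∀ v ∈ S, ∀ π : K, F0 v π = b v π := by
    intro v hv π
    simp only [F0, hv, dif_pos]
    rfl
  filter_upwards [h.strongLaw hF, h.ae_forall hxS] with ω hω hωS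
  rw [Metric.tendstoUniformlyOn_iff]
  intro ε hε
  filter_upwards [Metric.tendsto_nhds.1 hω ε hε] with n hn π hπ
  have h1 := (ContinuousMap.dist_apply_le_dist (f := (n : ℝ)⁻¹ • ∑ i ∈ Finset.range n, F (W i ω))
    (g := ∫ w, F w ∂μ) ⟨π, hπ⟩).trans_lt hn
  have e1 : (∫ w, F w ∂μ) ⟨π, hπ⟩ = ∫ w, a w * b (x w) π ∂μ := by
    have h2 := (ContinuousMap.evalCLM ℝ (⟨π, hπ⟩ : K)).integral_comp_comm hF
    refine h2.symm.trans (integral_congr_ae ?_)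
    filter_upwards [hxS] with w hw
    exact congrArg (a w * ·) (hev _ hw ⟨π, hπ⟩)
  have e2 : ((n : ℝ)⁻¹ • ∑ i ∈ Finset.range n, F (W i ω)) ⟨π, hπ⟩ =
      (n : ℝ)⁻¹ * ∑ i ∈ Finset.range n, a (W i ω) * b (x (W i ω)) π := by
    rw [ContinuousMap.smul_apply, ContinuousMap.sum_apply, smul_eq_mul]
    congr 1
    exact Finset.sum_congr rfl fun i _ => congrArg (a (W i ω) * ·) (hev _ (hωS i) ⟨π, hπ⟩)
  rwa [e1, e2, dist_comm] at h1

/-- The limit in the uniform law is continuous in the parameter. -/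
lemma continuousOn_integral {V : Type*} [MetricSpace V] [MeasurableSpace V]
    [BorelSpace V] {a : α → ℝ} (ha : Integrable a μ) {x : α → V} (hx : Measurable x)
    {S K : Set V} (hS : IsCompact S) (hK : IsCompact K) (hxS : ∀ᵐ w ∂μ, x w ∈ S)
    {b : V → V → ℝ} (hb : ContinuousOn (Function.uncurry b) (S ×ˢ K)) :
    ContinuousOn (fun π => ∫ w, a w * b (x w) π ∂μ) K := by
  classical
  obtain ⟨M, hM⟩ := (hS.prod hK).exists_bound_of_continuousOn hb
  intro π hπ
  refine tendsto_integral_filter_of_dominated_convergence (fun w => ‖a w‖ * M) ?_ ?_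
    (ha.norm.mul_const M) ?_
  · filter_upwards [self_mem_nhdsWithin] with π' hπ'
    refine ha.1.mul ?_
    have hm : Measurable (S.piecewise (fun v => b v π') 0) := by
      refine (ContinuousOn.measurable_piecewise ?_ continuousOn_const hS.measurableSet)
      exact hb.comp (f := fun v => (v, π')) (by fun_prop) (fun v hv => ⟨hv, hπ'⟩)
    refine (hm.comp hx).aestronglyMeasurable.congr ?_
    filter_upwards [hxS] with w hw
    simp [hw]
  · filter_upwards [self_mem_nhdsWithin] with π' hπ'
    filter_upwards [hxS] with w hw
    rw [norm_mul]
    exact mul_le_mul_of_nonneg_left (hM (x w, π') ⟨hw, hπ'⟩) (norm_nonneg _)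
  · filter_upwards [hxS] with w hw
    refine Tendsto.const_mul _ ?_
    exact (hb.comp (f := fun π' => (x w, π')) (by fun_prop) (fun v hv => ⟨hw, hv⟩)) π hπ

/-- Plug-in law of large numbers. -/
lemma plugInLaw (h : IIDSample W Q μ) {V : Type*} [MetricSpace V] [MeasurableSpace V]
    [BorelSpace V] {a : α → ℝ} (ha : Integrable a μ) {x : α → V} (hx : Measurable x)
    {S K : Set V} (hS : IsCompact S) (hK : IsCompact K) (hxS : ∀ᵐ w ∂μ, x w ∈ S)
    {b : V → V → ℝ} (hb : ContinuousOn (Function.uncurry b) (S ×ˢ K))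
    {π₀ : V} (hπ₀ : π₀ ∈ K) :
    ∀ᵐ ω ∂Q, ∀ πhat : ℕ → V, (∀ n, πhat n ∈ K) → Tendsto πhat atTop (𝓝 π₀) →
      Tendsto (fun n : ℕ =>
        (n : ℝ)⁻¹ * ∑ i ∈ Finset.range n, a (W i ω) * b (x (W i ω)) (πhat n)) atTop
        (𝓝 (∫ w, a w * b (x w) π₀ ∂μ)) := by
  -- The exceptional null set is that of the uniform law, so it does not depend on the sequence
  -- `πhat`, which may be any function of the sample.
  filter_upwards [h.uniformLaw ha hx hS hK hxS hb] with ω hω πhat hmem hlim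
  refine hω.tendsto_comp ((continuousOn_integral ha hx hS hK hxS hb) π₀ hπ₀) ?_
  exact tendsto_nhdsWithin_iff.2 ⟨hlim, Eventually.of_forall hmem⟩

/-- Normalized sums of centred square integrable functions are bounded in `L¹`. -/
lemma integral_abs_normalizedSum_le [IsProbabilityMeasure Q] (h : IIDSample W Q μ) {z : α → ℝ}
    (hz : MemLp z 2 μ) (h0 : ∫ w, z w ∂μ = 0) :
    ∀ n : ℕ, Integrable (fun ω => (√n)⁻¹ * ∑ i ∈ Finset.range n, z (W i ω)) Q ∧
      ∫ ω, |(√n)⁻¹ * ∑ i ∈ Finset.range n, z (W i ω)| ∂Q ≤ 1 + ∫ w, z w ^ 2 ∂μ := by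
  intro n
  have hi := h.identDistrib hz.1.aemeasurable
  have hm : ∀ i, MemLp (fun ω => z (W i ω)) 2 Q := fun i => (hi i).memLp_iff.2 hz
  have hs : MemLp (fun ω => ∑ i ∈ Finset.range n, z (W i ω)) 2 Q :=
    memLp_finsetSum _ fun i _ => hm i
  have hs' := hs.const_mul (√n)⁻¹
  refine ⟨hs'.integrable (by norm_num), ?_⟩
  have hmean : ∀ i, ∫ ω, z (W i ω) ∂Q = 0 := fun i => by rw [(hi i).integral_eq, h0]
  have hvar : ∫ ω, (∑ i ∈ Finset.range n, z (W i ω)) ^ 2 ∂Q = n * ∫ w, z w ^ 2 ∂μ := by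
    have h1 := IndepFun.variance_sum (μ := Q) (s := Finset.range n)
      (X := fun i ω => z (W i ω)) (fun i _ => hm i)
      (fun i _ j _ hij => (h.iIndepFun_comp hz.1.aemeasurable).indepFun hij)
    have h2 : ∀ i, variance (fun ω => z (W i ω)) Q = ∫ w, z w ^ 2 ∂μ := by
      intro i
      rw [(hi i).variance_eq, variance_of_integral_eq_zero hz.1.aemeasurable h0]
    simp only [h2, Finset.sum_const, Finset.card_range, nsmul_eq_mul] at h1
    rw [← h1, variance_of_integral_eq_zero]
    · simp
    · simpa using (Finset.aemeasurable_sum (Finset.range n) fun i _ => (hm i).1.aemeasurable)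
    · simp only [Finset.sum_apply]
      rw [integral_finsetSum _ fun i _ => (hm i).integrable (by norm_num)]
      simp [hmean]
  -- From |x| ≤ 1 + x²: a crude bound suffices, since only boundedness uniformly in `n` is used.
  have hle : ∫ ω, |(√n)⁻¹ * ∑ i ∈ Finset.range n, z (W i ω)| ∂Q ≤
      ∫ ω, (1 + ((√n)⁻¹ * ∑ i ∈ Finset.range n, z (W i ω)) ^ 2) ∂Q := by
    refine integral_mono (hs'.integrable (by norm_num)).abs
      ((integrable_const _).add hs'.integrable_sq) fun ω => ?_
    simp only
    nlinarith [sq_abs ((√n)⁻¹ * ∑ i ∈ Finset.range n, z (W i ω)),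
      sq_nonneg (|(√n)⁻¹ * ∑ i ∈ Finset.range n, z (W i ω)| - 1),
      abs_nonneg ((√n)⁻¹ * ∑ i ∈ Finset.range n, z (W i ω))]
  refine hle.trans ?_
  rw [integral_add (integrable_const _) hs'.integrable_sq]
  simp only [mul_pow, integral_const_mul, hvar, integral_const, probReal_univ, smul_eq_mul, mul_one]
  have hz2 : 0 ≤ ∫ w, z w ^ 2 ∂μ := integral_nonneg fun w => sq_nonneg _
  -- For `n = 0` the sum is empty and its second moment is 0; for `n > 0` the second moment equals
  -- that of `z` exactly.
  rcases Nat.eq_zero_or_pos n with rfl | hn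
  · simpa using hz2
  · have : (0 : ℝ) < n := by exact_mod_cast hn
    rw [inv_pow, Real.sq_sqrt this.le, ← mul_assoc, inv_mul_cancel₀ this.ne', one_mul]

end IIDSample

/-- A sequence that is eventually an arbitrarily small multiple of a sequence bounded in `L¹`
tends to zero in measure. -/
lemma tendstoInMeasure_zero_of_small_mul {Ω' : Type*} [MeasurableSpace Ω'] {Q : Measure Ω'}
    [IsProbabilityMeasure Q] {f N : ℕ → Ω' → ℝ} (hf : ∀ n, AEMeasurable (f n) Q)
    (hN0 : ∀ n ω, 0 ≤ N n ω) (hN : ∀ n, Integrable (N n) Q) {K : ℝ}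
    (hK : ∀ n, ∫ ω, N n ω ∂Q ≤ K)
    (hsmall : ∀ᵐ ω ∂Q, ∀ δ > 0, ∀ᶠ n in atTop, |f n ω| ≤ δ * (1 + N n ω)) :
    TendstoInMeasure Q f atTop (fun _ => 0) := by
  have hpos : ∀ n ω, 0 < 1 + N n ω := fun n ω => by linarith [hN0 n ω]
  -- After division by `1 + N` the sequence tends to zero almost surely, hence in measure; Markov's
  -- inequality then controls the event that `1 + N` is large.
  have hquot : TendstoInMeasure Q (fun n ω => f n ω / (1 + N n ω)) atTop (fun _ => 0) := by
    refine tendstoInMeasure_of_tendsto_ae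
      (fun n => ((hf n).div ((hN n).aemeasurable.const_add 1)).aestronglyMeasurable) ?_
    filter_upwards [hsmall] with ω hω
    rw [Metric.tendsto_nhds]
    intro ε hε
    filter_upwards [hω (ε / 2) (by positivity)] with n hn
    rw [dist_zero_right, norm_div, Real.norm_eq_abs, Real.norm_eq_abs, abs_of_pos (hpos n ω),
      div_lt_iff₀ (hpos n ω)]
    nlinarith [hpos n ω]
  rw [tendstoInMeasure_iff_measureReal_norm] at hquot ⊢
  intro ε hε
  simp only [sub_zero] at hquot ⊢
  have hK0 : 0 ≤ K := (integral_nonneg (hN0 0)).trans (hK 0)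
  rw [Metric.tendsto_nhds]
  intro η hη
  -- Chosen so that Markov's inequality gives probability at most (1 + K)/M = η/2 to the event `M ≤
  -- 1 + N`.
  set M : ℝ := 2 * (1 + K) / η with hM
  have hMpos : 0 < M := by positivity
  filter_upwards [Metric.tendsto_nhds.1 (hquot (ε / M) (by positivity)) (η / 2) (by positivity)]
    with n hn
  rw [dist_zero_right, Real.norm_of_nonneg measureReal_nonneg] at hn ⊢
  have hmarkov : M * Q.real {ω | M ≤ 1 + N n ω} ≤ 1 + K := by
    refine (mul_meas_ge_le_integral_of_nonneg (ae_of_all _ fun ω => (hpos n ω).le)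
      ((integrable_const 1).add (hN n)) M).trans ?_
    rw [integral_add (integrable_const _) (hN n)]
    simpa using hK n
  have hsub : {ω | ε ≤ ‖f n ω‖} ⊆
      {ω | ε / M ≤ ‖f n ω / (1 + N n ω)‖} ∪ {ω | M ≤ 1 + N n ω} := by
    intro ω hω
    by_cases hc : M ≤ 1 + N n ω
    · exact Or.inr hc
    · left
      rw [not_le] at hc
      simp only [Set.mem_ofPred_eq] at hω ⊢
      rw [norm_div, Real.norm_eq_abs (1 + N n ω), abs_of_pos (hpos n ω)]
      exact div_le_div₀ (norm_nonneg _) hω (hpos n ω) hc.le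
  calc Q.real {ω | ε ≤ ‖f n ω‖} ≤ _ := measureReal_mono hsub
    _ ≤ _ := measureReal_union_le _ _
    _ < η / 2 + η / 2 := by
      refine add_lt_add_of_lt_of_le hn ?_
      rw [← le_div_iff₀' hMpos] at hmarkov
      refine hmarkov.trans (le_of_eq ?_)
      rw [hM]; field_simp
    _ = η := by ring

/-! ### Multivariate central limit theorem -/

/-- Multivariate central limit theorem for centred square integrable functions of an i.i.d.
sample. -/
lemma IIDSample.centralLimit {α Ω' ι : Type*} [MeasurableSpace α] [MeasurableSpace Ω']
    [Fintype ι] [DecidableEq ι] {W : ℕ → Ω' → α} {Q : Measure Ω'} {μ : Measure α}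
    [IsProbabilityMeasure Q] [IsProbabilityMeasure μ] (h : IIDSample W Q μ) {z : ι → α → ℝ}
    (hz : ∀ q, MemLp (z q) 2 μ) (h0 : ∀ q, ∫ w, z q w ∂μ = 0) :
    TendstoInDistribution
      (fun (n : ℕ) ω => (WithLp.toLp 2 fun q => (√n)⁻¹ * ∑ i ∈ Finset.range n, z q (W i ω) :
        EuclideanSpace ℝ ι)) atTop (id : EuclideanSpace ℝ ι → EuclideanSpace ℝ ι)
      (fun _ => Q) (multivariateGaussian 0 (Matrix.of fun q r => ∫ w, z q w * z r w ∂μ)) := by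
  set V : Matrix ι ι ℝ := Matrix.of fun q r => ∫ w, z q w * z r w ∂μ with hV
  have hint : ∀ q r, Integrable (fun w => z q w * z r w) μ := fun q r =>
    (hz q).integrable_mul (hz r)
  have hquad : ∀ t : ι → ℝ, t ⬝ᵥ V *ᵥ t = ∫ w, (∑ q, t q * z q w) ^ 2 ∂μ := by
    intro t
    have : ∀ w, (∑ q, t q * z q w) ^ 2 = ∑ q, ∑ r, t q * (z q w * z r w * t r) := by
      intro w
      rw [sq, Finset.sum_mul_sum]
      refine Finset.sum_congr rfl fun q _ => Finset.sum_congr rfl fun r _ => by ring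
    simp_rw [this]
    rw [integral_finsetSum _ fun q _ => integrable_finsetSum _ fun r _ =>
      ((hint q r).mul_const _).const_mul _]
    simp only [dotProduct, Matrix.mulVec, hV, Matrix.of_apply, Finset.mul_sum]
    refine Finset.sum_congr rfl fun q _ => ?_
    rw [integral_finsetSum _ fun r _ => ((hint q r).mul_const _).const_mul _]
    refine Finset.sum_congr rfl fun r _ => ?_
    rw [integral_const_mul, integral_mul_const]
  have hpsd : V.PosSemidef := by
    refine Matrix.PosSemidef.of_dotProduct_mulVec_nonneg ?_ ?_
    · ext q r
      simp only [hV, Matrix.conjTranspose_apply, Matrix.of_apply, star_trivial]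
      exact integral_congr_ae (ae_of_all _ fun w => mul_comm _ _)
    · intro t
      rw [star_trivial, hquad]
      exact integral_nonneg fun w => sq_nonneg _
  have haem : ∀ q (i : ℕ), AEMeasurable (fun ω => z q (W i ω)) Q := fun q i =>
    (h.identDistrib (hz q).1.aemeasurable i).aemeasurable_fst
  have haev : ∀ n : ℕ, AEMeasurable (fun ω =>
      (WithLp.toLp 2 fun q => (√n)⁻¹ * ∑ i ∈ Finset.range n, z q (W i ω) :
        EuclideanSpace ℝ ι)) Q := by
    intro n
    refine (WithLp.measurable_toLp 2 (ι → ℝ)).comp_aemeasurable (aemeasurable_pi_lambda _ fun q => ?_)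
    exact (Finset.aemeasurable_fun_sum _ fun i _ => haem q i).const_mul _
  refine ⟨haev, aemeasurable_id, ?_⟩
  refine ProbabilityMeasure.tendsto_iff_tendsto_charFun.2 fun t => ?_
  simp only [ProbabilityMeasure.coe_mk, Measure.map_id]
  rw [charFun_multivariateGaussian hpsd]
  -- Cramér–Wold: the characteristic function of the vector at `t` is that of the normalized sum of
  -- the scalar `y` at 1, so the one-dimensional theorem applies.
  set y : α → ℝ := fun w => ∑ q, t q * z q w with hy
  have hyL : MemLp y 2 μ := memLp_finsetSum _ fun q _ => (hz q).const_mul _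
  have hy0 : ∫ w, y w ∂μ = 0 := by
    rw [hy, integral_finsetSum _ fun q _ => ((hz q).const_mul _).integrable (by norm_num)]
    simp [integral_const_mul, h0]
  have hid := h.identDistrib hyL.1.aemeasurable
  have hclt := tendstoInDistribution_inv_sqrt_mul_sum_sub (P := Q)
    (P' := gaussianReal 0 (Var[fun ω => y (W 0 ω); Q]).toNNReal) (Y := id)
    (X := fun i ω => y (W i ω)) HasLaw.id ((hid 0).memLp_iff.2 hyL)
    (h.iIndepFun_comp hyL.1.aemeasurable) (fun i => (hid i).trans (hid 0).symm)
  have hvar : Var[fun ω => y (W 0 ω); Q] = (t : ι → ℝ) ⬝ᵥ V *ᵥ (t : ι → ℝ) := by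
    rw [(hid 0).variance_eq, variance_of_integral_eq_zero hyL.1.aemeasurable hy0, hquad]
  have hchar := ProbabilityMeasure.tendsto_iff_tendsto_charFun.1 hclt.tendsto 1
  simp only [ProbabilityMeasure.coe_mk, Measure.map_id, charFun_gaussianReal] at hchar
  have hmean : ∫ ω, y (W 0 ω) ∂Q = 0 := by rw [(hid 0).integral_eq, hy0]
  convert hchar using 2 with n
  · rw [charFun_apply, charFun_apply, integral_map (haev n) (by fun_prop), integral_map _ (by fun_prop)]
    · congr 1
      ext ω
      congr 3
      rw [hmean]
      simp only [PiLp.inner_apply, hy, mul_zero, sub_zero]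
      simp only [RCLike.inner_apply, conj_trivial, one_mul]
      rw [Finset.sum_comm, Finset.mul_sum]
      refine Finset.sum_congr rfl fun q _ => ?_
      rw [Finset.mul_sum, Finset.mul_sum, Finset.mul_sum]
      refine Finset.sum_congr rfl fun i _ => by ring
    · simp only [hmean, mul_zero, sub_zero]
      exact (Finset.aemeasurable_fun_sum _ fun i _ => (hid i).aemeasurable_fst).const_mul _
  · rw [Real.coe_toNNReal _ (variance_nonneg _ _), hvar]
    simp

/-! ### Divided differences -/

/-- The divided difference of a `C¹` function is jointly continuous. -/
lemma continuousAt_dslope_uncurry {q : ℝ → ℝ} {u v : ℝ} (hu : ContDiffAt ℝ 1 q u)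
    (hv : ContDiffAt ℝ 1 q v) :
    ContinuousAt (fun p : ℝ × ℝ => dslope q p.1 p.2) (u, v) := by
  -- On the diagonal both consequences of C¹ regularity are needed: strict differentiability for
  -- difference quotients at two distinct nearby points, and continuity of the derivative for nearby
  -- diagonal points, where `dslope` is the derivative.
  rcases eq_or_ne u v with rfl | hne
  · have hstrict : HasStrictDerivAt q (deriv q u) u :=
      hu.hasStrictDerivAt one_ne_zero
    have hder : ContinuousAt (deriv q) u :=
      (hu.derivWithin (m := 0) (by norm_num)).continuousAt
    rw [Metric.continuousAt_iff']
    intro ε hε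
    have h1 := hstrict.hasStrictFDerivAt.isLittleO.def (half_pos hε)
    have h2 : ∀ᶠ p : ℝ × ℝ in 𝓝 (u, u), |deriv q p.1 - deriv q u| < ε := by
      have := hder.comp (f := fun p : ℝ × ℝ => p.1) (x := (u, u)) continuousAt_fst
      simpa [Real.dist_eq] using Metric.continuousAt_iff'.1 this ε hε
    filter_upwards [h1, h2] with p hp1 hp2
    simp only [dslope_same, Real.dist_eq]
    rcases eq_or_ne p.2 p.1 with he | he
    · rw [he, dslope_same]; exact hp2
    · rw [dslope_of_ne _ he, slope_def_field]
      have hd : p.2 - p.1 ≠ 0 := sub_ne_zero.2 he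
      have : (q p.2 - q p.1) / (p.2 - p.1) - deriv q u =
          -(q p.1 - q p.2 - (p.1 - p.2) * deriv q u) / (p.2 - p.1) := by
        field_simp; ring
      rw [this, abs_div, abs_neg, div_lt_iff₀ (abs_pos.2 hd)]
      simp only [Real.norm_eq_abs] at hp1
      refine hp1.trans_lt ?_
      rw [abs_sub_comm]
      have := abs_pos.2 hd
      nlinarith
  · have : (fun p : ℝ × ℝ => dslope q p.1 p.2) =ᶠ[𝓝 (u, v)]
        fun p => (q p.2 - q p.1) / (p.2 - p.1) := by
      have : ∀ᶠ p : ℝ × ℝ in 𝓝 (u, v), p.1 ≠ p.2 :=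
        (continuousAt_fst.ne_iff_eventually_ne continuousAt_snd).1 hne
      filter_upwards [this] with p hp
      rw [dslope_of_ne _ hp.symm, slope_def_field]
    refine ContinuousAt.congr ?_ this.symm
    have hqu : ContinuousAt q u := hu.continuousAt
    have hqv : ContinuousAt q v := hv.continuousAt
    refine ContinuousAt.div (ContinuousAt.sub ?_ ?_) (by fun_prop) (sub_ne_zero.2 hne.symm)
    · exact ContinuousAt.comp (g := q) (f := fun p : ℝ × ℝ => p.2) (x := (u, v)) hqv continuousAt_snd
    · exact ContinuousAt.comp (g := q) (f := fun p : ℝ × ℝ => p.1) (x := (u, v)) hqu continuousAt_fst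

end

end DiD

namespace DiD

noncomputable section

variable {T k : ℕ}

/-! ### Group indicators -/

lemma measurable_outcome (t : Period T) : Measurable (outcome (T := T) (k := k) t) := by
  unfold outcome; fun_prop

lemma measurable_covar : Measurable (covar (T := T) (k := k)) := by
  unfold covar; fun_prop

lemma measurable_treat (t : Period T) : Measurable (treat (T := T) (k := k) t) := by
  unfold treat; fun_prop

lemma measurable_longDiff (g t : Period T) : Measurable (longDiff (T := T) (k := k) g t) :=
  (measurable_outcome t).sub (measurable_outcome _)

lemma measurableSet_untreated (s : Period T) :
    MeasurableSet {w : Obs T k | treat s w = false} :=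
  measurable_treat s (measurableSet_singleton _)

lemma measurable_G (g : Period T) : Measurable (G (T := T) (k := k) g) := by
  unfold G
  refine Measurable.ite ?_ measurable_const measurable_const
  have h : MeasurableSet ({w : Obs T k | treat g w = true} ∩
      ⋂ s, ⋂ (_ : s < g), {w : Obs T k | treat s w = false}) :=
    (measurable_treat g (measurableSet_singleton true)).inter
      (MeasurableSet.iInter fun s => MeasurableSet.iInter fun _ => measurableSet_untreated s)
  convert h using 1
  ext w
  simp

lemma measurable_C : Measurable (C (T := T) (k := k)) := by
  unfold C
  refine Measurable.ite ?_ measurable_const measurable_const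
  convert MeasurableSet.iInter fun s => measurableSet_untreated (T := T) (k := k) s using 1
  ext w
  simp

/-- Observations are in group `g`, never treated, or neither. -/
lemma G_C_cases (g : Period T) (w : Obs T k) :
    (G g w = 1 ∧ C w = 0) ∨ (G g w = 0 ∧ C w = 1) ∨ (G g w = 0 ∧ C w = 0) := by
  by_cases hG : treat g w = true ∧ ∀ s, s < g → treat s w = false
  · left
    refine ⟨if_pos hG, if_neg fun h => ?_⟩
    simpa [hG.1] using h g
  · right
    by_cases hC : ∀ s, treat s w = false
    · exact Or.inl ⟨if_neg hG, if_pos hC⟩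
    · exact Or.inr ⟨if_neg hG, if_neg hC⟩

lemma norm_G_le (g : Period T) (w : Obs T k) : ‖G g w‖ ≤ 1 := by
  rcases G_C_cases g w with h | h | h <;> simp [h.1]

lemma norm_C_le (w : Obs T k) : ‖C w‖ ≤ 1 := by
  unfold C; split <;> simp

lemma C_nonneg (w : Obs T k) : 0 ≤ C w := by
  unfold C; split <;> simp

lemma G_nonneg (g : Period T) (w : Obs T k) : 0 ≤ G g w := by
  unfold G; split <;> simp

lemma C_sq (w : Obs T k) : C w ^ 2 = C w := by
  unfold C; split <;> simp

/-! ### The law of the observables -/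

/-- The properties of the law `μ` of an observation that drive the asymptotics for group `g`:
a smooth binary response model for `G_g` among the observations with `G_g + C = 1`, with compactly
supported covariates, link `Λ`, parameter set `Θ` and true parameter `π₀`. -/
structure BinaryResponse (μ : Measure (Obs T k)) (g : Period T) (Λ : ℝ → ℝ)
    (S Θ : Set (Fin k → ℝ)) (π₀ : Fin k → ℝ) : Prop where
  compact_support : IsCompact S
  compact_param : IsCompact Θ
  interior : π₀ ∈ interior Θ
  covar_mem : ∀ᵐ w ∂μ, covar w ∈ S
  pos : ∀ x ∈ S, ∀ π ∈ Θ, 0 < Λ (x ⬝ᵥ π)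
  lt_one : ∀ x ∈ S, ∀ π ∈ Θ, Λ (x ⬝ᵥ π) < 1
  inj : ∀ x ∈ S, ∀ π ∈ Θ, ∀ π' ∈ Θ, Λ (x ⬝ᵥ π) = Λ (x ⬝ᵥ π') → x ⬝ᵥ π = x ⬝ᵥ π'
  smooth : ∀ x ∈ S, ∀ π ∈ Θ, ContDiffAt ℝ 2 Λ (x ⬝ᵥ π)
  deriv_pos : ∀ x ∈ S, ∀ π ∈ Θ, 0 < deriv Λ (x ⬝ᵥ π)
  -- The moment form of p(X) = P(G = 1 | X, G + C = 1), which involves only the law of an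
  -- observation.
  balance : ∀ h : (Fin k → ℝ) → ℝ, Measurable h → (∃ B, ∀ x, |h x| ≤ B) →
    ∫ w, G g w * h (covar w) ∂μ = ∫ w, (G g w + C w) * (Λ (covar w ⬝ᵥ π₀) * h (covar w)) ∂μ
  posDef : ∀ v : Fin k → ℝ, v ≠ 0 → 0 < ∫ w, (G g w + C w) * (covar w ⬝ᵥ v) ^ 2 ∂μ
  G_pos : 0 < ∫ w, G g w ∂μ
  moment : ∀ t, MemLp (outcome (T := T) (k := k) t) 2 μ

/-- The score of a treated observation, as a function of the index. -/
def scoreG (Λ : ℝ → ℝ) (u : ℝ) : ℝ := deriv Λ u / Λ u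

/-- The score of a never treated observation, as a function of the index. -/
def scoreC (Λ : ℝ → ℝ) (u : ℝ) : ℝ := -deriv Λ u / (1 - Λ u)

/-- The odds, as a function of the index. -/
def odds (Λ : ℝ → ℝ) (u : ℝ) : ℝ := Λ u / (1 - Λ u)

/-- The score of the log-likelihood. -/
def score (g : Period T) (Λ : ℝ → ℝ) (π : Fin k → ℝ) (w : Obs T k) (a : Fin k) : ℝ :=
  covar w a * (G g w * scoreG Λ (covar w ⬝ᵥ π) + C w * scoreC Λ (covar w ⬝ᵥ π))

lemma ctrlWeight_eq (Λ : ℝ → ℝ) (π : Fin k → ℝ) (w : Obs T k) :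
    ctrlWeight Λ π w = C w * odds Λ (covar w ⬝ᵥ π) := by
  unfold ctrlWeight odds; ring

/-! ### Score, odds and information matrix in the binary response model. -/

namespace BinaryResponse

variable {μ : Measure (Obs T k)} {g : Period T} {Λ : ℝ → ℝ}
  {S Θ : Set (Fin k → ℝ)} {π₀ : Fin k → ℝ}

lemma param_mem (h : BinaryResponse μ g Λ S Θ π₀) : π₀ ∈ Θ := interior_subset h.interior

lemma contDiffAt_deriv (h : BinaryResponse μ g Λ S Θ π₀) {x π : Fin k → ℝ} (hx : x ∈ S)
    (hπ : π ∈ Θ) : ContDiffAt ℝ 1 (deriv Λ) (x ⬝ᵥ π) :=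
  (h.smooth x hx π hπ).derivWithin (by norm_num)

lemma contDiffAt_link (h : BinaryResponse μ g Λ S Θ π₀) {x π : Fin k → ℝ} (hx : x ∈ S)
    (hπ : π ∈ Θ) : ContDiffAt ℝ 1 Λ (x ⬝ᵥ π) :=
  (h.smooth x hx π hπ).of_le (by norm_num)

lemma contDiffAt_scoreG (h : BinaryResponse μ g Λ S Θ π₀) {x π : Fin k → ℝ} (hx : x ∈ S)
    (hπ : π ∈ Θ) : ContDiffAt ℝ 1 (scoreG Λ) (x ⬝ᵥ π) :=
  (h.contDiffAt_deriv hx hπ).div (h.contDiffAt_link hx hπ) (h.pos x hx π hπ).ne'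

lemma contDiffAt_scoreC (h : BinaryResponse μ g Λ S Θ π₀) {x π : Fin k → ℝ} (hx : x ∈ S)
    (hπ : π ∈ Θ) : ContDiffAt ℝ 1 (scoreC Λ) (x ⬝ᵥ π) :=
  (h.contDiffAt_deriv hx hπ).neg.div (contDiffAt_const.sub (h.contDiffAt_link hx hπ))
    (sub_pos.2 (h.lt_one x hx π hπ)).ne'

lemma contDiffAt_odds (h : BinaryResponse μ g Λ S Θ π₀) {x π : Fin k → ℝ} (hx : x ∈ S)
    (hπ : π ∈ Θ) : ContDiffAt ℝ 1 (odds Λ) (x ⬝ᵥ π) :=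
  (h.contDiffAt_link hx hπ).div (contDiffAt_const.sub (h.contDiffAt_link hx hπ))
    (sub_pos.2 (h.lt_one x hx π hπ)).ne'

/-- Together with C² = C, this is the source of the factor (C/(1-p))² ṗ in `Mvec`: it is the
derivative of the control weight in the index. -/
lemma deriv_odds (h : BinaryResponse μ g Λ S Θ π₀) {x π : Fin k → ℝ} (hx : x ∈ S) (hπ : π ∈ Θ) :
    deriv (odds Λ) (x ⬝ᵥ π) = deriv Λ (x ⬝ᵥ π) / (1 - Λ (x ⬝ᵥ π)) ^ 2 := by
  have hd := ((h.contDiffAt_link hx hπ).differentiableAt one_ne_zero).hasDerivAt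
  have hne := (sub_pos.2 (h.lt_one x hx π hπ)).ne'
  have := hd.div (hd.const_sub 1) hne
  refine this.deriv.trans ?_
  congr 1; ring

/-- The expected derivative of the score given the covariates. -/
lemma deriv_score (h : BinaryResponse μ g Λ S Θ π₀) {x π : Fin k → ℝ} (hx : x ∈ S) (hπ : π ∈ Θ) :
    Λ (x ⬝ᵥ π) * deriv (scoreG Λ) (x ⬝ᵥ π) + (1 - Λ (x ⬝ᵥ π)) * deriv (scoreC Λ) (x ⬝ᵥ π) =
      -(deriv Λ (x ⬝ᵥ π) ^ 2 / (Λ (x ⬝ᵥ π) * (1 - Λ (x ⬝ᵥ π)))) := by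
  have hd := ((h.contDiffAt_link hx hπ).differentiableAt one_ne_zero).hasDerivAt
  have hd2 := ((h.contDiffAt_deriv hx hπ).differentiableAt one_ne_zero).hasDerivAt
  have hne := (sub_pos.2 (h.lt_one x hx π hπ)).ne'
  have hne0 := (h.pos x hx π hπ).ne'
  -- In the weighted sum of the two derivatives the terms with the second derivative of `Λ` cancel.
  have h1 : deriv (scoreG Λ) (x ⬝ᵥ π) = _ := (hd2.div hd hne0).deriv
  have h2 : deriv (scoreC Λ) (x ⬝ᵥ π) = _ := (hd2.neg.div (hd.const_sub 1) hne).deriv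
  rw [h1, h2]
  field_simp
  simp only [Pi.neg_apply]
  ring

lemma continuousOn_index {f : ℝ → ℝ} (hf : ∀ x ∈ S, ∀ π ∈ Θ, ContinuousAt f (x ⬝ᵥ π)) :
    ContinuousOn (Function.uncurry fun x π : Fin k → ℝ => f (x ⬝ᵥ π)) (S ×ˢ Θ) := by
  intro p hp
  refine ContinuousAt.continuousWithinAt ?_
  refine ContinuousAt.comp (g := f) (f := fun p : (Fin k → ℝ) × (Fin k → ℝ) => p.1 ⬝ᵥ p.2)
    (hf p.1 hp.1 p.2 hp.2) ?_
  exact (continuous_fst.dotProduct continuous_snd).continuousAt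

/-- Joint continuity lets the uniform law act on divided differences anchored at `π₀`, which replace
derivatives at intermediate points. -/
lemma continuousOn_index_dslope (hπ₀ : π₀ ∈ Θ) {f : ℝ → ℝ}
    (hf : ∀ x ∈ S, ∀ π ∈ Θ, ContDiffAt ℝ 1 f (x ⬝ᵥ π)) :
    ContinuousOn (Function.uncurry fun x π : Fin k → ℝ => dslope f (x ⬝ᵥ π₀) (x ⬝ᵥ π))
      (S ×ˢ Θ) := by
  intro p hp
  refine ContinuousAt.continuousWithinAt ?_
  refine ContinuousAt.comp (g := fun q : ℝ × ℝ => dslope f q.1 q.2)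
    (f := fun p : (Fin k → ℝ) × (Fin k → ℝ) => (p.1 ⬝ᵥ π₀, p.1 ⬝ᵥ p.2))
    (continuousAt_dslope_uncurry (hf p.1 hp.1 π₀ hπ₀) (hf p.1 hp.1 p.2 hp.2)) ?_
  exact ((continuous_fst.dotProduct continuous_const).prodMk
    (continuous_fst.dotProduct continuous_snd)).continuousAt

lemma continuousOn_index_right {f : ℝ → ℝ} {π : Fin k → ℝ} (hπ : π ∈ Θ)
    (hf : ∀ x ∈ S, ∀ π ∈ Θ, ContinuousAt f (x ⬝ᵥ π)) :
    ContinuousOn (fun x : Fin k → ℝ => f (x ⬝ᵥ π)) S :=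
  (continuousOn_index hf).comp (f := fun x => (x, π)) (by fun_prop) fun _ hx => ⟨hx, hπ⟩

lemma continuousOn_coord (a : Fin k) : ContinuousOn (fun x : Fin k → ℝ => x a) S := by fun_prop

open Classical in
/-- A function of the covariates that is continuous on their support agrees on the support with
a bounded measurable function. -/
lemma exists_bounded_extension (h : BinaryResponse μ g Λ S Θ π₀) {f : (Fin k → ℝ) → ℝ}
    (hf : ContinuousOn f S) :
    ∃ f' : (Fin k → ℝ) → ℝ, Measurable f' ∧ (∃ B, ∀ x, |f' x| ≤ B) ∧ ∀ x ∈ S, f x = f' x := by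
  obtain ⟨B, hB⟩ := h.compact_support.exists_bound_of_continuousOn hf
  refine ⟨S.piecewise f 0, hf.measurable_piecewise continuousOn_const
    h.compact_support.measurableSet, ⟨max B 0, fun x => ?_⟩, fun x hx => ?_⟩
  · by_cases hx : x ∈ S
    · simpa [hx] using Or.inl (hB x hx)
    · simp [hx]
  · simp [hx]

lemma memLp_mul (h : BinaryResponse μ g Λ S Θ π₀) {p : ENNReal} {z : Obs T k → ℝ}
    (hz : MemLp z p μ) {f : (Fin k → ℝ) → ℝ} (hf : ContinuousOn f S) :
    MemLp (fun w => z w * f (covar w)) p μ := by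
  obtain ⟨f', hm, ⟨B, hB⟩, hff⟩ := h.exists_bounded_extension hf
  have hae : (fun w => f' (covar w)) =ᵐ[μ] fun w => f (covar w) := by
    filter_upwards [h.covar_mem] with w hw using (hff _ hw).symm
  refine MemLp.of_le_mul (c := B) hz
    (hz.1.mul ((hm.comp measurable_covar).aestronglyMeasurable.congr hae)) ?_
  filter_upwards [hae] with w hw
  rw [norm_mul, ← hw, mul_comm]
  exact mul_le_mul_of_nonneg_right (hB _) (norm_nonneg _)

lemma memLp_G [IsFiniteMeasure μ] (p : ENNReal) : MemLp (G (T := T) (k := k) g) p μ :=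
  MemLp.of_bound (measurable_G g).aestronglyMeasurable 1 (ae_of_all _ (norm_G_le g))

lemma memLp_C [IsFiniteMeasure μ] (p : ENNReal) : MemLp (C (T := T) (k := k)) p μ :=
  MemLp.of_bound measurable_C.aestronglyMeasurable 1 (ae_of_all _ norm_C_le)

lemma integrable_G [IsFiniteMeasure μ] (h : BinaryResponse μ g Λ S Θ π₀)
    {f : (Fin k → ℝ) → ℝ} (hf : ContinuousOn f S) :
    Integrable (fun w => G g w * f (covar w)) μ :=
  memLp_one_iff_integrable.1 (h.memLp_mul (memLp_G 1) hf)

lemma integrable_C [IsFiniteMeasure μ] (h : BinaryResponse μ g Λ S Θ π₀)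
    {f : (Fin k → ℝ) → ℝ} (hf : ContinuousOn f S) :
    Integrable (fun w => C w * f (covar w)) μ :=
  memLp_one_iff_integrable.1 (h.memLp_mul (memLp_C 1) hf)

lemma integrable_G_add_C [IsFiniteMeasure μ] (h : BinaryResponse μ g Λ S Θ π₀)
    {f : (Fin k → ℝ) → ℝ} (hf : ContinuousOn f S) :
    Integrable (fun w => (G g w + C w) * f (covar w)) μ := by
  refine ((h.integrable_G hf).add (h.integrable_C hf)).congr (ae_of_all _ fun w => ?_)
  simp only [Pi.add_apply]; ring

/-- Iterated expectations given the covariates. -/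
lemma integral_G_add_C [IsFiniteMeasure μ] (h : BinaryResponse μ g Λ S Θ π₀)
    {f₁ f₂ : (Fin k → ℝ) → ℝ} (hf₁ : ContinuousOn f₁ S) (hf₂ : ContinuousOn f₂ S) :
    ∫ w, (G g w * f₁ (covar w) + C w * f₂ (covar w)) ∂μ =
      ∫ w, (G g w + C w) * (Λ (covar w ⬝ᵥ π₀) * f₁ (covar w)
        + (1 - Λ (covar w ⬝ᵥ π₀)) * f₂ (covar w)) ∂μ := by
  have hb : ∀ f : (Fin k → ℝ) → ℝ, ContinuousOn f S → ∫ w, G g w * f (covar w) ∂μ =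
      ∫ w, (G g w + C w) * (Λ (covar w ⬝ᵥ π₀) * f (covar w)) ∂μ := by
    intro f hf
    obtain ⟨f', hm, hB, hff⟩ := h.exists_bounded_extension hf
    have := h.balance f' hm hB
    convert this using 1 <;> refine integral_congr_ae ?_ <;>
      filter_upwards [h.covar_mem] with w hw <;> rw [hff _ hw]
  have hΛ : ContinuousOn (fun x : Fin k → ℝ => Λ (x ⬝ᵥ π₀)) S :=
    continuousOn_index_right h.param_mem fun x hx π hπ => (h.smooth x hx π hπ).continuousAt
  have hd : ContinuousOn (fun x => f₁ x - f₂ x) S := hf₁.sub hf₂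
  have hGf := h.integrable_G hf₁
  have hI : Integrable (fun w => (G g w + C w) * f₂ (covar w)) μ := h.integrable_G_add_C hf₂
  have hI2 : Integrable (fun w => (G g w + C w) *
      (Λ (covar w ⬝ᵥ π₀) * (f₁ (covar w) - f₂ (covar w)))) μ :=
    h.integrable_G_add_C (hΛ.mul hd)
  -- Writing G f₁ + C f₂ as G (f₁ - f₂) + (G + C) f₂ leaves only a G-term, to which `balance`
  -- applies.
  calc ∫ w, (G g w * f₁ (covar w) + C w * f₂ (covar w)) ∂μ
      = ∫ w, (G g w * (f₁ (covar w) - f₂ (covar w)) + (G g w + C w) * f₂ (covar w)) ∂μ := by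
        congr 1; ext w; ring
    _ = ∫ w, (G g w + C w) * (Λ (covar w ⬝ᵥ π₀) * (f₁ (covar w) - f₂ (covar w))) ∂μ
        + ∫ w, (G g w + C w) * f₂ (covar w) ∂μ := by
        rw [integral_add (h.integrable_G hd) hI, hb _ hd]
    _ = _ := by
        rw [← integral_add hI2 hI]
        congr 1; ext w; ring

/-- E[C p/(1-p)] = E[(G+C)(1-p) p/(1-p)] = E[(G+C) p] = E[G]. The treated and control weights thus
share one positive normalizing constant. -/
lemma integral_ctrlWeight [IsFiniteMeasure μ] (h : BinaryResponse μ g Λ S Θ π₀) :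
    ∫ w, ctrlWeight Λ π₀ w ∂μ = ∫ w, G g w ∂μ := by
  have ho : ContinuousOn (fun x : Fin k → ℝ => odds Λ (x ⬝ᵥ π₀)) S :=
    continuousOn_index_right h.param_mem fun x hx π hπ => (h.contDiffAt_odds hx hπ).continuousAt
  have h1 := h.integral_G_add_C (f₁ := fun _ => 0) continuousOn_const ho
  have h2 := h.integral_G_add_C (f₁ := fun _ => 1) (f₂ := fun _ => 0) continuousOn_const
    continuousOn_const
  simp only [mul_zero, zero_add, mul_one, add_zero] at h1 h2
  simp_rw [ctrlWeight_eq]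
  rw [h1, h2]
  refine integral_congr_ae ?_
  filter_upwards [h.covar_mem] with w hw
  have hne := (sub_pos.2 (h.lt_one _ hw π₀ h.param_mem)).ne'
  unfold odds
  field_simp

lemma ctrlWeight_pos [IsFiniteMeasure μ] (h : BinaryResponse μ g Λ S Θ π₀) :
    0 < ∫ w, ctrlWeight Λ π₀ w ∂μ := h.integral_ctrlWeight ▸ h.G_pos

/-- Given the covariates, the score averages to p·ṗ/p - (1-p)·ṗ/(1-p) = 0. -/
lemma integral_score [IsFiniteMeasure μ] (h : BinaryResponse μ g Λ S Θ π₀) (a : Fin k) :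
    ∫ w, score g Λ π₀ w a ∂μ = 0 := by
  have hG : ContinuousOn (fun x : Fin k → ℝ => scoreG Λ (x ⬝ᵥ π₀)) S :=
    continuousOn_index_right h.param_mem fun x hx π hπ => (h.contDiffAt_scoreG hx hπ).continuousAt
  have hC : ContinuousOn (fun x : Fin k → ℝ => scoreC Λ (x ⬝ᵥ π₀)) S :=
    continuousOn_index_right h.param_mem fun x hx π hπ => (h.contDiffAt_scoreC hx hπ).continuousAt
  have h1 := h.integral_G_add_C (f₁ := fun x => x a * scoreG Λ (x ⬝ᵥ π₀))
    (f₂ := fun x => x a * scoreC Λ (x ⬝ᵥ π₀)) ((continuousOn_coord a).mul hG) ((continuousOn_coord a).mul hC)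
  have : ∀ w : Obs T k, score g Λ π₀ w a =
      G g w * (covar w a * scoreG Λ (covar w ⬝ᵥ π₀))
        + C w * (covar w a * scoreC Λ (covar w ⬝ᵥ π₀)) := fun w => by unfold score; ring
  simp_rw [this, h1]
  refine integral_eq_zero_of_ae ?_
  filter_upwards [h.covar_mem] with w hw
  have hne := (sub_pos.2 (h.lt_one _ hw π₀ h.param_mem)).ne'
  have hne0 := (h.pos _ hw π₀ h.param_mem).ne'
  unfold scoreG scoreC
  simp only [Pi.zero_apply]
  field_simp
  ring

lemma memLp_score [IsFiniteMeasure μ] (h : BinaryResponse μ g Λ S Θ π₀) (a : Fin k) :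
    MemLp (fun w => score g Λ π₀ w a) 2 μ := by
  have hG : ContinuousOn (fun x : Fin k → ℝ => scoreG Λ (x ⬝ᵥ π₀)) S :=
    continuousOn_index_right h.param_mem fun x hx π hπ => (h.contDiffAt_scoreG hx hπ).continuousAt
  have hC : ContinuousOn (fun x : Fin k → ℝ => scoreC Λ (x ⬝ᵥ π₀)) S :=
    continuousOn_index_right h.param_mem fun x hx π hπ => (h.contDiffAt_scoreC hx hπ).continuousAt
  have h1 := (h.memLp_mul (memLp_G (g := g) 2) ((continuousOn_coord a).mul hG)).add
    (h.memLp_mul (memLp_C 2) ((continuousOn_coord a).mul hC))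
  refine (memLp_congr_ae (ae_of_all _ fun w => ?_)).1 h1
  simp only [Pi.add_apply, Pi.mul_apply, score]
  ring

/-- The information equality: `deriv_score` integrated against the products of covariates. It
identifies the limit of the matrices in `linearization`. -/
lemma integral_deriv_score [IsFiniteMeasure μ] (h : BinaryResponse μ g Λ S Θ π₀) (a b : Fin k) :
    ∫ w, G g w * (covar w a * covar w b * deriv (scoreG Λ) (covar w ⬝ᵥ π₀)) ∂μ
      + ∫ w, C w * (covar w a * covar w b * deriv (scoreC Λ) (covar w ⬝ᵥ π₀)) ∂μ
      = -infoMatrix μ g Λ π₀ a b := by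
  have hG : ContinuousOn (fun x : Fin k → ℝ => x a * x b * deriv (scoreG Λ) (x ⬝ᵥ π₀)) S :=
    ((continuousOn_coord a).mul (continuousOn_coord b)).mul <|
      continuousOn_index_right h.param_mem fun x hx π hπ =>
        ((h.contDiffAt_scoreG hx hπ).derivWithin (m := 0) (by norm_num)).continuousAt
  have hC : ContinuousOn (fun x : Fin k → ℝ => x a * x b * deriv (scoreC Λ) (x ⬝ᵥ π₀)) S :=
    ((continuousOn_coord a).mul (continuousOn_coord b)).mul <|
      continuousOn_index_right h.param_mem fun x hx π hπ =>
        ((h.contDiffAt_scoreC hx hπ).derivWithin (m := 0) (by norm_num)).continuousAt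
  rw [← integral_add (h.integrable_G hG) (h.integrable_C hC), h.integral_G_add_C hG hC]
  simp only [infoMatrix, Matrix.of_apply]
  rw [← integral_neg]
  refine integral_congr_ae ?_
  filter_upwards [h.covar_mem] with w hw
  have := h.deriv_score hw h.param_mem
  linear_combination (G g w + C w) * (covar w a * covar w b) * this

/-- The information matrix is invertible. -/
lemma isUnit_det_infoMatrix [IsFiniteMeasure μ] (h : BinaryResponse μ g Λ S Θ π₀) :
    (infoMatrix μ g Λ π₀).det ≠ 0 := by
  intro hdet
  obtain ⟨v, hv, hmv⟩ := Matrix.exists_mulVec_eq_zero_iff.2 hdet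
  set f : (Fin k → ℝ) → ℝ := fun x =>
    deriv Λ (x ⬝ᵥ π₀) ^ 2 / (Λ (x ⬝ᵥ π₀) * (1 - Λ (x ⬝ᵥ π₀))) with hf
  have hpos : ∀ x ∈ S, 0 < f x := fun x hx =>
    div_pos (pow_pos (h.deriv_pos x hx π₀ h.param_mem) 2)
      (mul_pos (h.pos x hx π₀ h.param_mem) (sub_pos.2 (h.lt_one x hx π₀ h.param_mem)))
  have hfc : ContinuousOn f S := by
    refine continuousOn_index_right (f := fun u => deriv Λ u ^ 2 / (Λ u * (1 - Λ u)))
      h.param_mem fun x hx π hπ => ?_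
    have h1 := (h.contDiffAt_deriv hx hπ).continuousAt
    have h2 := (h.contDiffAt_link hx hπ).continuousAt
    exact (h1.pow 2).div (h2.mul (continuousAt_const.sub h2))
      (mul_pos (h.pos x hx π hπ) (sub_pos.2 (h.lt_one x hx π hπ))).ne'
  have hint : ∀ e : (Fin k → ℝ) → ℝ, ContinuousOn e S →
      Integrable (fun w => (G g w + C w) * e (covar w)) μ := fun e he => h.integrable_G_add_C he
  have hcv : ContinuousOn (fun x : Fin k → ℝ => x ⬝ᵥ v) S :=
    (continuous_id.dotProduct continuous_const).continuousOn
  -- A kernel vector `v` makes this quadratic form vanish; as `f > 0` on `S`, (G+C)(X'v)² is then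
  -- null almost everywhere, against `posDef`.
  have hquad : ∫ w, (G g w + C w) * (f (covar w) * (covar w ⬝ᵥ v) ^ 2) ∂μ =
      v ⬝ᵥ infoMatrix μ g Λ π₀ *ᵥ v := by
    have : ∀ w : Obs T k, (G g w + C w) * (f (covar w) * (covar w ⬝ᵥ v) ^ 2) =
        ∑ a, ∑ b, v a * ((G g w + C w) * (f (covar w) * (covar w a * covar w b)) * v b) := by
      intro w
      rw [sq, dotProduct, Finset.sum_mul_sum]
      simp only [Finset.mul_sum]
      refine Finset.sum_congr rfl fun a _ => Finset.sum_congr rfl fun b _ => by ring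
    have hab : ∀ a b, Integrable
        (fun w => (G g w + C w) * (f (covar w) * (covar w a * covar w b))) μ := fun a b =>
      hint (fun x => f x * (x a * x b))
        (hfc.mul ((continuousOn_coord a).mul (continuousOn_coord b)))
    simp_rw [this]
    rw [integral_finsetSum _ fun a _ => integrable_finsetSum _ fun b _ =>
      ((hab a b).mul_const _).const_mul _]
    simp only [dotProduct, Matrix.mulVec, Finset.mul_sum]
    refine Finset.sum_congr rfl fun a _ => ?_
    rw [integral_finsetSum _ fun b _ => ((hab a b).mul_const _).const_mul _]
    refine Finset.sum_congr rfl fun b _ => ?_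
    rw [integral_const_mul, integral_mul_const]
    congr 2
    simp only [infoMatrix, Matrix.of_apply, hf]
    congr 1; ext w; ring
  rw [hmv, dotProduct_zero] at hquad
  have hnn : 0 ≤ᵐ[μ] fun w => (G g w + C w) * (f (covar w) * (covar w ⬝ᵥ v) ^ 2) := by
    filter_upwards [h.covar_mem] with w hw
    exact mul_nonneg (add_nonneg (G_nonneg g w) (C_nonneg w))
      (mul_nonneg (hpos _ hw).le (sq_nonneg _))
  have hz := (integral_eq_zero_iff_of_nonneg_ae hnn (hint _ (hfc.mul (hcv.pow 2)))).1 hquad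
  refine (h.posDef v hv).ne' (integral_eq_zero_of_ae ?_)
  filter_upwards [hz, h.covar_mem] with w hw hwS
  have hfw := (hpos _ hwS).ne'
  simp only [Pi.zero_apply, mul_eq_zero] at hw ⊢
  tauto

/-- (G+C)(G-p)ṗ/(p(1-p)) is ṗ/p when G = 1, -ṗ/(1-p) when C = 1 and 0 otherwise. The cancellations
use 0 < p < 1, known only for covariates in `S`. -/
lemma xi_eq (h : BinaryResponse μ g Λ S Θ π₀) {w : Obs T k} (hw : covar w ∈ S) :
    xi μ g Λ π₀ w = (infoMatrix μ g Λ π₀)⁻¹ *ᵥ score g Λ π₀ w := by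
  unfold xi
  congr 1
  ext a
  have hne := (sub_pos.2 (h.lt_one _ hw π₀ h.param_mem)).ne'
  have hne0 := (h.pos _ hw π₀ h.param_mem).ne'
  simp only [Pi.smul_apply, smul_eq_mul, score, scoreG, scoreC]
  rcases G_C_cases g w with hc | hc | hc <;> rw [hc.1, hc.2] <;> field_simp <;> ring

end BinaryResponse

end

end DiD

namespace DiD

noncomputable section

variable {T k : ℕ}

/-! ### Maximum likelihood -/

/-- Gibbs' inequality for two Bernoulli laws. -/
lemma bernoulli_gibbs_lt {p q : ℝ} (hp : 0 < p) (hp1 : p < 1) (hq : 0 < q) (hq1 : q < 1)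
    (hne : q ≠ p) :
    p * Real.log q + (1 - p) * Real.log (1 - q) <
      p * Real.log p + (1 - p) * Real.log (1 - p) := by
  have hp' : 0 < 1 - p := sub_pos.2 hp1
  have hq' : 0 < 1 - q := sub_pos.2 hq1
  -- Of the two bounds log x ≤ x - 1 one strict instance is enough; the weighted right-hand sides, q
  -- - p and p - q, cancel.
  have h1 : Real.log q - Real.log p < q / p - 1 := by
    rw [← Real.log_div hq.ne' hp.ne']
    exact Real.log_lt_sub_one_of_pos (div_pos hq hp) (by rwa [Ne, div_eq_one_iff_eq hp.ne'])
  have h2 : Real.log (1 - q) - Real.log (1 - p) ≤ (1 - q) / (1 - p) - 1 := by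
    rw [← Real.log_div hq'.ne' hp'.ne']
    exact Real.log_le_sub_one_of_pos (div_pos hq' hp')
  have h3 := mul_lt_mul_of_pos_left h1 hp
  have h4 := mul_le_mul_of_nonneg_left h2 hp'.le
  have h5 : p * (q / p - 1) = q - p := by field_simp
  have h6 : (1 - p) * ((1 - q) / (1 - p) - 1) = p - q := by field_simp; ring
  linarith

/-- Where G + C = 1 one has 1 - G = C, and elsewhere G = C = 0. The filter disappears and the
log-likelihood is a full sample sum, to which laws of large numbers apply. -/
lemma logLik_eq (g : Period T) (Λ : ℝ → ℝ) (n : ℕ) (w : ℕ → Obs T k) (π : Fin k → ℝ) :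
    logLik g Λ n w π = ∑ i ∈ Finset.range n, (G g (w i) * Real.log (Λ (covar (w i) ⬝ᵥ π))
      + C (w i) * Real.log (1 - Λ (covar (w i) ⬝ᵥ π))) := by
  unfold logLik
  rw [Finset.sum_filter]
  refine Finset.sum_congr rfl fun i _ => ?_
  rcases G_C_cases g (w i) with h | h | h <;> simp [h.1, h.2]

namespace BinaryResponse

variable {μ : Measure (Obs T k)} {g : Period T} {Λ : ℝ → ℝ}
  {S Θ : Set (Fin k → ℝ)} {π₀ : Fin k → ℝ}

lemma continuousAt_logG (h : BinaryResponse μ g Λ S Θ π₀) :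
    ∀ x ∈ S, ∀ π ∈ Θ, ContinuousAt (fun u => Real.log (Λ u)) (x ⬝ᵥ π) := fun x hx π hπ =>
  (h.contDiffAt_link hx hπ).continuousAt.log (h.pos x hx π hπ).ne'

lemma continuousAt_logC (h : BinaryResponse μ g Λ S Θ π₀) :
    ∀ x ∈ S, ∀ π ∈ Θ, ContinuousAt (fun u => Real.log (1 - Λ u)) (x ⬝ᵥ π) := fun x hx π hπ =>
  (continuousAt_const.sub (h.contDiffAt_link hx hπ).continuousAt).log
    (sub_pos.2 (h.lt_one x hx π hπ)).ne'

/-- The population log-likelihood is uniquely maximized at the true parameter. -/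
lemma population_logLik_lt [IsFiniteMeasure μ] (h : BinaryResponse μ g Λ S Θ π₀)
    {π : Fin k → ℝ} (hπ : π ∈ Θ) (hne : π ≠ π₀) :
    ∫ w, G g w * Real.log (Λ (covar w ⬝ᵥ π)) ∂μ
        + ∫ w, C w * Real.log (1 - Λ (covar w ⬝ᵥ π)) ∂μ <
      ∫ w, G g w * Real.log (Λ (covar w ⬝ᵥ π₀)) ∂μ
        + ∫ w, C w * Real.log (1 - Λ (covar w ⬝ᵥ π₀)) ∂μ := by
  have hΛ : ContinuousOn (fun x : Fin k → ℝ => Λ (x ⬝ᵥ π₀)) S :=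
    continuousOn_index_right h.param_mem fun x hx π hπ => (h.smooth x hx π hπ).continuousAt
  have hG : ∀ π ∈ Θ, ContinuousOn (fun x : Fin k → ℝ => Real.log (Λ (x ⬝ᵥ π))) S :=
    fun π hπ => continuousOn_index_right hπ h.continuousAt_logG
  have hC : ∀ π ∈ Θ, ContinuousOn (fun x : Fin k → ℝ => Real.log (1 - Λ (x ⬝ᵥ π))) S :=
    fun π hπ => continuousOn_index_right hπ h.continuousAt_logC
  set e : (Fin k → ℝ) → (Fin k → ℝ) → ℝ := fun π x => Λ (x ⬝ᵥ π₀) * Real.log (Λ (x ⬝ᵥ π))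
    + (1 - Λ (x ⬝ᵥ π₀)) * Real.log (1 - Λ (x ⬝ᵥ π)) with he
  have hec : ∀ π ∈ Θ, ContinuousOn (e π) S := fun π hπ =>
    (hΛ.mul (hG π hπ)).add ((continuousOn_const.sub hΛ).mul (hC π hπ))
  have hL : ∀ π ∈ Θ, ∫ w, G g w * Real.log (Λ (covar w ⬝ᵥ π)) ∂μ
        + ∫ w, C w * Real.log (1 - Λ (covar w ⬝ᵥ π)) ∂μ =
        ∫ w, (G g w + C w) * e π (covar w) ∂μ := fun π hπ => by
    rw [← integral_add (h.integrable_G (hG π hπ)) (h.integrable_C (hC π hπ)),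
      h.integral_G_add_C (hG π hπ) (hC π hπ)]
  rw [hL π hπ, hL π₀ h.param_mem, ← sub_pos,
    ← integral_sub (h.integrable_G_add_C (hec _ h.param_mem)) (h.integrable_G_add_C (hec π hπ))]
  have hlt : ∀ x ∈ S, Λ (x ⬝ᵥ π) ≠ Λ (x ⬝ᵥ π₀) → e π x < e π₀ x := fun x hx hne =>
    bernoulli_gibbs_lt (h.pos x hx π₀ h.param_mem) (h.lt_one x hx π₀ h.param_mem)
      (h.pos x hx π hπ) (h.lt_one x hx π hπ) hne
  have hle : ∀ x ∈ S, e π x ≤ e π₀ x := fun x hx => by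
    by_cases hx' : Λ (x ⬝ᵥ π) = Λ (x ⬝ᵥ π₀)
    · simp only [he, hx', le_refl]
    · exact (hlt x hx hx').le
  have hnn : 0 ≤ᵐ[μ] fun w => (G g w + C w) * e π₀ (covar w) - (G g w + C w) * e π (covar w) := by
    filter_upwards [h.covar_mem] with w hw
    simp only [Pi.zero_apply]
    rw [← mul_sub]
    exact mul_nonneg (add_nonneg (G_nonneg g w) (C_nonneg w)) (sub_nonneg.2 (hle _ hw))
  -- Equality would force equal fitted probabilities wherever G + C ≠ 0, hence equal indices by
  -- `inj`, so that (G+C)(X'(π - π₀))² = 0 almost everywhere, against `posDef`.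
  refine lt_of_le_of_ne (integral_nonneg_of_ae hnn) fun h0 => ?_
  have hz := (integral_eq_zero_iff_of_nonneg_ae hnn ((h.integrable_G_add_C
    (hec _ h.param_mem)).sub (h.integrable_G_add_C (hec π hπ)))).1 h0.symm
  refine (h.posDef (π - π₀) (sub_ne_zero.2 hne)).ne' (integral_eq_zero_of_ae ?_)
  filter_upwards [hz, h.covar_mem] with w hw hwS
  simp only [Pi.zero_apply] at hw ⊢
  rw [← mul_sub, mul_eq_zero] at hw
  rcases hw with hw | hw
  · rw [hw, zero_mul]
  · have hΛeq : Λ (covar w ⬝ᵥ π) = Λ (covar w ⬝ᵥ π₀) := by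
      by_contra hc
      linarith [hlt _ hwS hc]
    rw [dotProduct_sub, h.inj _ hwS π hπ π₀ h.param_mem hΛeq]
    simp

variable {Ω' : Type*} [MeasurableSpace Ω'] {Q : Measure Ω'} {W : ℕ → Ω' → Obs T k}

/-- Strong consistency of the maximum likelihood estimator. -/
lemma consistency [IsFiniteMeasure μ] (h : BinaryResponse μ g Λ S Θ π₀)
    (hW : IIDSample W Q μ) :
    ∀ᵐ ω ∂Q, ∀ πhat : ℕ → Fin k → ℝ, (∀ n, IsMLE g Λ Θ n (fun i => W i ω) (πhat n)) →
      Tendsto πhat atTop (𝓝 π₀) := by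
  have hbG := continuousOn_index h.continuousAt_logG
  have hbC := continuousOn_index h.continuousAt_logC
  have hiG := memLp_one_iff_integrable.1 (memLp_G (μ := μ) (g := g) 1)
  have hiC := memLp_one_iff_integrable.1 (memLp_C (T := T) (k := k) (μ := μ) 1)
  have hcont := (IIDSample.continuousOn_integral hiG measurable_covar h.compact_support
    h.compact_param h.covar_mem hbG).add (IIDSample.continuousOn_integral hiC measurable_covar
      h.compact_support h.compact_param h.covar_mem hbC)
  filter_upwards [hW.uniformLaw hiG measurable_covar h.compact_support h.compact_param
    h.covar_mem hbG, hW.uniformLaw hiC measurable_covar h.compact_support h.compact_param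
    h.covar_mem hbC] with ω hωG hωC πhat hmle
  have hunif := Metric.tendstoUniformlyOn_iff.1 (hωG.add hωC)
  -- By compactness of `Θ` it suffices to exclude every cluster point other than `π₀`.
  refine h.compact_param.tendsto_nhds_of_unique_mapClusterPt
    (Eventually.of_forall fun n => (hmle n).1) fun π hπ hcl => ?_
  by_contra hne
  have hlt := h.population_logLik_lt hπ hne
  set L : (Fin k → ℝ) → ℝ := fun π => ∫ w, G g w * Real.log (Λ (covar w ⬝ᵥ π)) ∂μ
        + ∫ w, C w * Real.log (1 - Λ (covar w ⬝ᵥ π)) ∂μ with hL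
  set Ln : ℕ → (Fin k → ℝ) → ℝ := fun n π =>
    (n : ℝ)⁻¹ * ∑ i ∈ Finset.range n, G g (W i ω) * Real.log (Λ (covar (W i ω) ⬝ᵥ π)) +
    (n : ℝ)⁻¹ * ∑ i ∈ Finset.range n, C (W i ω) * Real.log (1 - Λ (covar (W i ω) ⬝ᵥ π)) with hLn
  have hLL : ∀ n π, Ln n π = (n : ℝ)⁻¹ * logLik g Λ n (fun i => W i ω) π := fun n π => by
    rw [logLik_eq, Finset.sum_add_distrib, mul_add]
  have hmax : ∀ n, Ln n π₀ ≤ Ln n (πhat n) := fun n => by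
    rw [hLL, hLL]
    exact mul_le_mul_of_nonneg_left ((hmle n).2 π₀ h.param_mem) (by positivity)
  -- A third of the gap for each of three errors: continuity of `L` at the cluster point, and the
  -- uniform law at `πhat n` and at `π₀`.
  have hε : 0 < (L π₀ - L π) / 3 := by
    have : L π < L π₀ := hlt
    linarith
  have hev := hunif _ hε
  have hLc : ContinuousOn L Θ := hcont
  have hnear : ∀ᶠ π' in 𝓝[Θ] π, L π' < L π + (L π₀ - L π) / 3 :=
    (hLc π hπ).eventually_lt_const (by linarith)
  rw [eventually_nhdsWithin_iff] at hnear
  obtain ⟨n, hn1, hn2⟩ := ((mapClusterPt_iff_frequently.1 hcl _ hnear).and_eventually hev).exists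
  have h1 : L (πhat n) < L π + (L π₀ - L π) / 3 := hn1 (hmle n).1
  have h2 : |L (πhat n) - Ln n (πhat n)| < (L π₀ - L π) / 3 := hn2 _ (hmle n).1
  have h3 : |L π₀ - Ln n π₀| < (L π₀ - L π) / 3 := hn2 _ h.param_mem
  have h4 := hmax n
  rw [abs_lt] at h2 h3
  linarith [h2.1, h2.2, h3.1, h3.2]

/-- First-order condition at an interior maximum. -/
lemma sum_score_eq_zero (h : BinaryResponse μ g Λ S Θ π₀) {w : ℕ → Obs T k}
    (hw : ∀ i, covar (w i) ∈ S) {n : ℕ} {π : Fin k → ℝ} (hπ : IsMLE g Λ Θ n w π)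
    (hint : Θ ∈ 𝓝 π) (a : Fin k) :
    ∑ i ∈ Finset.range n, score g Λ π (w i) a = 0 := by
  -- A line through the maximizer in the a-th coordinate direction; it stays in `Θ` for small `s`
  -- because `Θ` is a neighbourhood of the maximizer.
  set c : ℝ → Fin k → ℝ := fun s => π + s • Pi.single a 1 with hc
  have hc0 : c 0 = π := by simp [hc]
  have hcc : Continuous c := by fun_prop
  have hmax : IsLocalMax (fun s => logLik g Λ n w (c s)) 0 := by
    have : ∀ᶠ s in 𝓝 (0 : ℝ), c s ∈ Θ := hcc.continuousAt.eventually (by rwa [hc0])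
    filter_upwards [this] with s hs
    rw [hc0]
    exact hπ.2 _ hs
  have hu : ∀ i, ∀ s, covar (w i) ⬝ᵥ c s = covar (w i) ⬝ᵥ π + s * covar (w i) a := fun i s => by
    simp [hc, dotProduct_add, dotProduct_smul]
  have hder : ∀ i, HasDerivAt (fun s => G g (w i) * Real.log (Λ (covar (w i) ⬝ᵥ c s))
      + C (w i) * Real.log (1 - Λ (covar (w i) ⬝ᵥ c s))) (score g Λ π (w i) a) 0 := by
    intro i
    have hx := hw i
    have hdi : HasDerivAt (fun s => covar (w i) ⬝ᵥ c s) (covar (w i) a) 0 := by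
      simp_rw [hu]
      simpa using ((hasDerivAt_id (0 : ℝ)).mul_const (covar (w i) a)).const_add
        (covar (w i) ⬝ᵥ π)
    have h0 : covar (w i) ⬝ᵥ c 0 = covar (w i) ⬝ᵥ π := by rw [hc0]
    have hdΛ : HasDerivAt Λ (deriv Λ (covar (w i) ⬝ᵥ π)) (covar (w i) ⬝ᵥ c 0) := by
      rw [h0]
      exact ((h.contDiffAt_link hx hπ.1).differentiableAt one_ne_zero).hasDerivAt
    have hcomp := HasDerivAt.comp (0 : ℝ) hdΛ hdi
    have hp := (h.pos _ hx π hπ.1).ne'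
    have hp1 := (sub_pos.2 (h.lt_one _ hx π hπ.1)).ne'
    have h1 := hcomp.log (by simpa [h0] using hp)
    have h2 := (hcomp.const_sub 1).log (by simpa [h0] using hp1)
    have h3 := (h1.const_mul (G g (w i))).add (h2.const_mul (C (w i)))
    refine h3.congr_deriv ?_
    simp only [Function.comp_apply, h0, score, scoreG, scoreC]
    ring
  have hsum := HasDerivAt.fun_sum (u := Finset.range n) fun i _ => hder i
  simp_rw [← logLik_eq] at hsum
  exact hmax.hasDerivAt_eq_zero hsum

/-- Exact linearization of the likelihood equations. -/
lemma linearization [IsFiniteMeasure μ] (h : BinaryResponse μ g Λ S Θ π₀)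
    (hW : IIDSample W Q μ) :
    ∀ᵐ ω ∂Q, ∀ πhat : ℕ → Fin k → ℝ, (∀ n, IsMLE g Λ Θ n (fun i => W i ω) (πhat n)) →
      ∃ A : ℕ → Matrix (Fin k) (Fin k) ℝ, Tendsto A atTop (𝓝 (-infoMatrix μ g Λ π₀)) ∧
        ∀ᶠ n in atTop, (fun a => sampleMean n (fun i => W i ω) fun w => score g Λ π₀ w a)
          + A n *ᵥ (πhat n - π₀) = 0 := by
  have hiG := memLp_one_iff_integrable.1 (memLp_G (μ := μ) (g := g) 1)
  have hiC := memLp_one_iff_integrable.1 (memLp_C (T := T) (k := k) (μ := μ) 1)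
  have hb : ∀ f : ℝ → ℝ, (∀ x ∈ S, ∀ π ∈ Θ, ContDiffAt ℝ 1 f (x ⬝ᵥ π)) → ∀ a b : Fin k,
      ContinuousOn (Function.uncurry fun x π : Fin k → ℝ =>
        x a * x b * dslope f (x ⬝ᵥ π₀) (x ⬝ᵥ π)) (S ×ˢ Θ) := fun f hf a b => by
    refine ContinuousOn.mul ?_ (continuousOn_index_dslope h.param_mem hf)
    fun_prop
  have hpG : ∀ᵐ ω ∂Q, ∀ a b, _ := ae_all_iff.2 fun a => ae_all_iff.2 fun b =>
    hW.plugInLaw hiG measurable_covar h.compact_support h.compact_param h.covar_mem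
      (hb _ (fun x hx π hπ => h.contDiffAt_scoreG hx hπ) a b) h.param_mem
  have hpC : ∀ᵐ ω ∂Q, ∀ a b, _ := ae_all_iff.2 fun a => ae_all_iff.2 fun b =>
    hW.plugInLaw hiC measurable_covar h.compact_support h.compact_param h.covar_mem
      (hb _ (fun x hx π hπ => h.contDiffAt_scoreC hx hπ) a b) h.param_mem
  filter_upwards [hpG, hpC, h.consistency hW, hW.ae_forall h.covar_mem]
    with ω hωG hωC hcons hωS πhat hmle
  have hlim := hcons πhat hmle
  -- Averaged divided differences of the score between `π₀` and `πhat n`. They make the expansion an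
  -- identity, and at `π₀` they reduce to derivatives, which gives the limit.
  refine ⟨fun n => Matrix.of fun a b =>
    (n : ℝ)⁻¹ * ∑ i ∈ Finset.range n, G g (W i ω) * (covar (W i ω) a * covar (W i ω) b *
        dslope (scoreG Λ) (covar (W i ω) ⬝ᵥ π₀) (covar (W i ω) ⬝ᵥ πhat n)) +
    (n : ℝ)⁻¹ * ∑ i ∈ Finset.range n, C (W i ω) * (covar (W i ω) a * covar (W i ω) b *
        dslope (scoreC Λ) (covar (W i ω) ⬝ᵥ π₀) (covar (W i ω) ⬝ᵥ πhat n)), ?_, ?_⟩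
  · refine tendsto_pi_nhds.2 fun a => tendsto_pi_nhds.2 fun b => ?_
    have := (hωG a b πhat (fun n => (hmle n).1) hlim).add
      (hωC a b πhat (fun n => (hmle n).1) hlim)
    simp only [dslope_same] at this
    rw [h.integral_deriv_score a b] at this
    exact this
  -- The first-order condition holds only once consistency has brought `πhat n` into the interior of
  -- `Θ`, hence the statement for large `n`.
  · filter_upwards [hlim (isOpen_interior.mem_nhds h.interior)] with n hn
    have hfoc := h.sum_score_eq_zero hωS (hmle n) (mem_interior_iff_mem_nhds.1 hn)
    ext a
    change (n : ℝ)⁻¹ * ∑ i ∈ Finset.range n, score g Λ π₀ (W i ω) a +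
      ∑ b, (_ + _) * (πhat n b - π₀ b) = 0
    rw [← mul_zero ((n : ℝ)⁻¹), ← hfoc a]
    have hi : ∀ i, score g Λ (πhat n) (W i ω) a = score g Λ π₀ (W i ω) a +
        ∑ b, (G g (W i ω) * (covar (W i ω) a * covar (W i ω) b *
          dslope (scoreG Λ) (covar (W i ω) ⬝ᵥ π₀) (covar (W i ω) ⬝ᵥ πhat n)) +
        C (W i ω) * (covar (W i ω) a * covar (W i ω) b *
          dslope (scoreC Λ) (covar (W i ω) ⬝ᵥ π₀) (covar (W i ω) ⬝ᵥ πhat n))) *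
          (πhat n b - π₀ b) := by
      intro i
      set x := covar (W i ω)
      have hd : ∀ f : ℝ → ℝ, f (x ⬝ᵥ πhat n) = f (x ⬝ᵥ π₀) +
          (∑ b, x b * (πhat n b - π₀ b)) * dslope f (x ⬝ᵥ π₀) (x ⬝ᵥ πhat n) := fun f => by
        have h1 := sub_smul_dslope f (x ⬝ᵥ π₀) (x ⬝ᵥ πhat n)
        rw [← dotProduct_sub, smul_eq_mul] at h1
        have h2 : x ⬝ᵥ (πhat n - π₀) = ∑ b, x b * (πhat n b - π₀ b) := rfl
        rw [← h2, h1]; ring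
      have hs : ∀ π, score g Λ π (W i ω) a =
        x a * (G g (W i ω) * scoreG Λ (x ⬝ᵥ π) + C (W i ω) * scoreC Λ (x ⬝ᵥ π)) := fun _ => rfl
      rw [hs, hs, hd (scoreG Λ), hd (scoreC Λ)]
      have : ∀ b, (G g (W i ω) * (x a * x b * dslope (scoreG Λ) (x ⬝ᵥ π₀) (x ⬝ᵥ πhat n)) +
          C (W i ω) * (x a * x b * dslope (scoreC Λ) (x ⬝ᵥ π₀) (x ⬝ᵥ πhat n))) *
          (πhat n b - π₀ b) = (x a * (G g (W i ω) * dslope (scoreG Λ) (x ⬝ᵥ π₀) (x ⬝ᵥ πhat n) +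
          C (W i ω) * dslope (scoreC Λ) (x ⬝ᵥ π₀) (x ⬝ᵥ πhat n))) *
          (x b * (πhat n b - π₀ b)) := fun b => by ring
      simp_rw [this]
      rw [← Finset.mul_sum]
      ring
    simp_rw [hi, Finset.sum_add_distrib, mul_add]
    congr 1
    rw [Finset.sum_comm, Finset.mul_sum]
    refine Finset.sum_congr rfl fun b _ => ?_
    rw [← Finset.sum_mul, Finset.sum_add_distrib]
    ring

end BinaryResponse

end

end DiD

namespace DiD

noncomputable section

variable {T k : ℕ}

/-! ### Asymptotic linearity -/

/-- Cramer's rule: the inverse is the adjugate divided by the determinant, both continuous in the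
entries. -/
lemma tendsto_matrix_inv {ι : Type*} [Fintype ι] [DecidableEq ι] {A : ℕ → Matrix ι ι ℝ}
    {B : Matrix ι ι ℝ} (hA : Tendsto A atTop (𝓝 B)) (hB : B.det ≠ 0) :
    Tendsto (fun n => (A n)⁻¹) atTop (𝓝 B⁻¹) := by
  simp only [Matrix.inv_def, Ring.inverse_eq_inv']
  have h1 : Tendsto (fun n => (A n).det) atTop (𝓝 B.det) :=
    ((Continuous.matrix_det continuous_id).tendsto B).comp hA
  have h2 : Tendsto (fun n => (A n).adjugate) atTop (𝓝 B.adjugate) :=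
    ((Continuous.matrix_adjugate continuous_id).tendsto B).comp hA
  exact (h1.inv₀ hB).smul h2

lemma sampleMean_add (n : ℕ) (w : ℕ → Obs T k) (f f' : Obs T k → ℝ) :
    sampleMean n w (fun v => f v + f' v) = sampleMean n w f + sampleMean n w f' := by
  simp only [sampleMean, Finset.sum_add_distrib, mul_add]

lemma sampleMean_sub (n : ℕ) (w : ℕ → Obs T k) (f f' : Obs T k → ℝ) :
    sampleMean n w (fun v => f v - f' v) = sampleMean n w f - sampleMean n w f' := by
  simp only [sampleMean, Finset.sum_sub_distrib, mul_sub]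

lemma sampleMean_mul_const (n : ℕ) (w : ℕ → Obs T k) (f : Obs T k → ℝ) (c : ℝ) :
    sampleMean n w (fun v => f v * c) = sampleMean n w f * c := by
  simp only [sampleMean, ← Finset.sum_mul, mul_assoc]

lemma sampleMean_sum {ι : Type*} (s : Finset ι) (n : ℕ) (w : ℕ → Obs T k)
    (f : ι → Obs T k → ℝ) :
    sampleMean n w (fun v => ∑ a ∈ s, f a v) = ∑ a ∈ s, sampleMean n w (f a) := by
  simp only [sampleMean]
  rw [Finset.sum_comm, Finset.mul_sum]

lemma sampleMean_congr {n : ℕ} {w : ℕ → Obs T k} {f f' : Obs T k → ℝ}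
    (h : ∀ i, f (w i) = f' (w i)) : sampleMean n w f = sampleMean n w f' := by
  simp only [sampleMean, h]

lemma attHat_eq (g t : Period T) (Λ : ℝ → ℝ) (π : Fin k → ℝ) (n : ℕ) (w : ℕ → Obs T k) :
    attHat g t Λ π n w =
      sampleMean n w (fun v => G g v * longDiff g t v) / sampleMean n w (G g)
        - sampleMean n w (fun v => ctrlWeight Λ π v * longDiff g t v)
          / sampleMean n w (ctrlWeight Λ π) := by
  rw [attHat, div_eq_mul_inv, div_eq_mul_inv, ← sampleMean_mul_const, ← sampleMean_mul_const,
    ← sampleMean_sub]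
  congr 1
  ext v
  ring

/-- The estimand: the difference of the weighted means of the long difference. -/
def estimand (μ : Measure (Obs T k)) (g t : Period T) (Λ : ℝ → ℝ) (π : Fin k → ℝ) : ℝ :=
  ∫ v, wG μ g v * longDiff g t v ∂μ - meanC μ g t Λ π

/-- The centred long difference of the treated. -/
def centredG (μ : Measure (Obs T k)) (g t : Period T) (w : Obs T k) : ℝ :=
  G g w * (longDiff g t w - ∫ v, wG μ g v * longDiff g t v ∂μ)

/-- The centred weighted long difference of the never treated. -/
def centredC (μ : Measure (Obs T k)) (g t : Period T) (Λ : ℝ → ℝ) (π : Fin k → ℝ)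
    (w : Obs T k) : ℝ :=
  ctrlWeight Λ π w * (longDiff g t w - meanC μ g t Λ π)

namespace BinaryResponse

variable {μ : Measure (Obs T k)} {g : Period T} {Λ : ℝ → ℝ}
  {S Θ : Set (Fin k → ℝ)} {π₀ : Fin k → ℝ}

lemma memLp_longDiff (h : BinaryResponse μ g Λ S Θ π₀) (t : Period T) :
    MemLp (longDiff (T := T) (k := k) g t) 2 μ :=
  (h.moment t).sub (h.moment _)

lemma continuousOn_odds (h : BinaryResponse μ g Λ S Θ π₀) {π : Fin k → ℝ} (hπ : π ∈ Θ) :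
    ContinuousOn (fun x : Fin k → ℝ => odds Λ (x ⬝ᵥ π)) S :=
  continuousOn_index_right hπ fun _ hx _ hπ => (h.contDiffAt_odds hx hπ).continuousAt

lemma memLp_G_mul {z : Obs T k → ℝ} (hz : MemLp z 2 μ) :
    MemLp (fun w => G g w * z w) 2 μ := by
  refine MemLp.of_le hz ((measurable_G g).aestronglyMeasurable.mul hz.1) (ae_of_all _ fun w => ?_)
  rw [norm_mul]
  exact mul_le_of_le_one_left (norm_nonneg _) (norm_G_le g w)

lemma memLp_C_mul {z : Obs T k → ℝ} (hz : MemLp z 2 μ) :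
    MemLp (fun w => C w * z w) 2 μ := by
  refine MemLp.of_le hz (measurable_C.aestronglyMeasurable.mul hz.1) (ae_of_all _ fun w => ?_)
  rw [norm_mul]
  exact mul_le_of_le_one_left (norm_nonneg _) (norm_C_le w)

lemma memLp_ctrlWeight_mul (h : BinaryResponse μ g Λ S Θ π₀) {z : Obs T k → ℝ}
    (hz : MemLp z 2 μ) : MemLp (fun w => ctrlWeight Λ π₀ w * z w) 2 μ := by
  have := h.memLp_mul (memLp_C_mul hz) (h.continuousOn_odds h.param_mem)
  refine (memLp_congr_ae (ae_of_all _ fun w => ?_)).1 this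
  simp only [ctrlWeight_eq]
  ring

lemma memLp_centredG [IsFiniteMeasure μ] (h : BinaryResponse μ g Λ S Θ π₀) (t : Period T) :
    MemLp (centredG μ g t) 2 μ :=
  memLp_G_mul ((h.memLp_longDiff t).sub (memLp_const _))

lemma memLp_centredC [IsFiniteMeasure μ] (h : BinaryResponse μ g Λ S Θ π₀) (t : Period T) :
    MemLp (centredC μ g t Λ π₀) 2 μ :=
  h.memLp_ctrlWeight_mul ((h.memLp_longDiff t).sub (memLp_const _))

lemma integral_centredG [IsFiniteMeasure μ] (h : BinaryResponse μ g Λ S Θ π₀) (t : Period T) :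
    ∫ w, centredG μ g t w ∂μ = 0 := by
  have h1 : ∫ v, wG μ g v * longDiff g t v ∂μ =
      (∫ v, G g v * longDiff g t v ∂μ) / ∫ v, G g v ∂μ := by
    rw [← integral_div]
    congr 1; ext v; unfold wG; ring
  simp only [centredG, mul_sub]
  rw [integral_sub ((memLp_G_mul (h.memLp_longDiff t)).integrable (by norm_num))
    ((memLp_one_iff_integrable.1 (memLp_G 1)).mul_const _), integral_mul_const, h1,
    mul_div_cancel₀ _ h.G_pos.ne', sub_self]

lemma integral_centredC [IsFiniteMeasure μ] (h : BinaryResponse μ g Λ S Θ π₀) (t : Period T) :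
    ∫ w, centredC μ g t Λ π₀ w ∂μ = 0 := by
  have h1 : meanC μ g t Λ π₀ =
      (∫ v, ctrlWeight Λ π₀ v * longDiff g t v ∂μ) / ∫ v, ctrlWeight Λ π₀ v ∂μ := by
    rw [← integral_div, meanC]
    congr 1; ext v; unfold wC; ring
  have hi : Integrable (ctrlWeight (T := T) Λ π₀) μ := by
    simpa using (h.memLp_ctrlWeight_mul (memLp_const 1)).integrable (by norm_num)
  simp only [centredC, mul_sub]
  rw [integral_sub ((h.memLp_ctrlWeight_mul (h.memLp_longDiff t)).integrable (by norm_num))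
    (hi.mul_const _), integral_mul_const, h1, mul_div_cancel₀ _ h.ctrlWeight_pos.ne', sub_self]

/-- Displays `psi` as a fixed linear combination of centred functions and scores, through M'(I⁻¹s) =
(M'I⁻¹)s. Integrability, centring and the comparison in `remainder_le` all rest on this form. -/
lemma psi_eq (h : BinaryResponse μ g Λ S Θ π₀) (t : Period T) {w : Obs T k}
    (hw : covar w ∈ S) :
    psi μ g t Λ π₀ w = centredG μ g t w * (∫ v, G g v ∂μ)⁻¹
      - centredC μ g t Λ π₀ w * (∫ v, ctrlWeight Λ π₀ v ∂μ)⁻¹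
      - ∑ a, score g Λ π₀ w a * (Mvec μ g t Λ π₀ ᵥ* (infoMatrix μ g Λ π₀)⁻¹) a := by
  have : Mvec μ g t Λ π₀ ⬝ᵥ xi μ g Λ π₀ w =
      ∑ a, score g Λ π₀ w a * (Mvec μ g t Λ π₀ ᵥ* (infoMatrix μ g Λ π₀)⁻¹) a := by
    rw [h.xi_eq hw, Matrix.dotProduct_mulVec, dotProduct_comm]
    rfl
  rw [psi, psiC, this, psiG, wG, wC, centredG, centredC]
  ring

lemma memLp_psi [IsFiniteMeasure μ] (h : BinaryResponse μ g Λ S Θ π₀) (t : Period T) :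
    MemLp (psi μ g t Λ π₀) 2 μ := by
  have h1 := (((h.memLp_centredG t).mul_const (∫ v, G g v ∂μ)⁻¹).sub
    ((h.memLp_centredC t).mul_const (∫ v, ctrlWeight Λ π₀ v ∂μ)⁻¹)).sub
    (memLp_finsetSum Finset.univ fun a _ => (h.memLp_score a).mul_const
      ((Mvec μ g t Λ π₀ ᵥ* (infoMatrix μ g Λ π₀)⁻¹) a))
  refine (memLp_congr_ae ?_).1 h1
  filter_upwards [h.covar_mem] with w hw
  rw [h.psi_eq t hw]
  rfl

lemma integral_psi [IsFiniteMeasure μ] (h : BinaryResponse μ g Λ S Θ π₀) (t : Period T) :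
    ∫ w, psi μ g t Λ π₀ w ∂μ = 0 := by
  have hae : psi μ g t Λ π₀ =ᵐ[μ] fun w => centredG μ g t w * (∫ v, G g v ∂μ)⁻¹
      - centredC μ g t Λ π₀ w * (∫ v, ctrlWeight Λ π₀ v ∂μ)⁻¹
      - ∑ a, score g Λ π₀ w a * (Mvec μ g t Λ π₀ ᵥ* (infoMatrix μ g Λ π₀)⁻¹) a := by
    filter_upwards [h.covar_mem] with w hw using h.psi_eq t hw
  have i1 := ((h.memLp_centredG t).integrable one_le_two).mul_const (∫ v, G g v ∂μ)⁻¹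
  have i2 := ((h.memLp_centredC t).integrable one_le_two).mul_const
    (∫ v, ctrlWeight Λ π₀ v ∂μ)⁻¹
  have i3 := fun a => ((h.memLp_score a).integrable one_le_two).mul_const
    ((Mvec μ g t Λ π₀ ᵥ* (infoMatrix μ g Λ π₀)⁻¹) a)
  have i12 : Integrable (fun w => centredG μ g t w * (∫ v, G g v ∂μ)⁻¹
      - centredC μ g t Λ π₀ w * (∫ v, ctrlWeight Λ π₀ v ∂μ)⁻¹) μ := i1.sub i2
  rw [integral_congr_ae hae, integral_sub i12 (integrable_finsetSum _ fun a _ => i3 a),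
    integral_sub i1 i2, integral_finsetSum _ fun a _ => i3 a]
  simp only [integral_mul_const, h.integral_centredG, h.integral_centredC, h.integral_score,
    zero_mul, sub_zero, Finset.sum_const_zero]

variable {Ω' : Type*} [MeasurableSpace Ω'] {Q : Measure Ω'} {W : ℕ → Ω' → Obs T k}

/-- The size of the normalized sums that enter the remainder of the linearization. -/
def remainderScale (μ : Measure (Obs T k)) (g t : Period T) (Λ : ℝ → ℝ) (π : Fin k → ℝ)
    (n : ℕ) (w : ℕ → Obs T k) : ℝ :=
  |sampleMean n w (centredG μ g t)| + |sampleMean n w (centredC μ g t Λ π)|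
    + ∑ a, |sampleMean n w fun v => score g Λ π v a|

/-- An identity for every `f`: the divided difference absorbs the Taylor remainder. -/
lemma index_taylor (f : ℝ → ℝ) (x π π' : Fin k → ℝ) :
    f (x ⬝ᵥ π') = f (x ⬝ᵥ π) + ∑ a, x a * dslope f (x ⬝ᵥ π) (x ⬝ᵥ π') * (π' a - π a) := by
  have h1 := sub_smul_dslope f (x ⬝ᵥ π) (x ⬝ᵥ π')
  rw [← dotProduct_sub, smul_eq_mul, dotProduct, Finset.sum_mul] at h1
  rw [← sub_eq_iff_eq_add', ← h1]
  refine Finset.sum_congr rfl fun a _ => ?_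
  simp only [Pi.sub_apply]
  ring

/-- The remainder of the linearization is of smaller order than the linear terms. -/
lemma remainder_le [IsFiniteMeasure μ] (h : BinaryResponse μ g Λ S Θ π₀)
    (hW : IIDSample W Q μ) (t : Period T) :
    ∀ᵐ ω ∂Q, ∀ πhat : ℕ → Fin k → ℝ, (∀ n, IsMLE g Λ Θ n (fun i => W i ω) (πhat n)) →
      ∀ δ > 0, ∀ᶠ n in atTop,
        |attHat g t Λ (πhat n) n (fun i => W i ω) - estimand μ g t Λ π₀
            - sampleMean n (fun i => W i ω) (psi μ g t Λ π₀)| ≤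
          δ * remainderScale μ g t Λ π₀ n (fun i => W i ω) := by
  have hiG := memLp_one_iff_integrable.1 (memLp_G (μ := μ) (g := g) 1)
  have hiC := memLp_one_iff_integrable.1 (memLp_C (T := T) (k := k) (μ := μ) 1)
  set mC := meanC μ g t Λ π₀ with hmC
  set mG := ∫ v, wG μ g v * longDiff g t v ∂μ with hmG
  have hiCD : Integrable (fun w => C w * (longDiff g t w - mC)) μ :=
    (memLp_C_mul ((h.memLp_longDiff t).sub (memLp_const _))).integrable one_le_two
  have hlawG := hW.strongLaw hiG
  have hlawO := hW.plugInLaw hiC measurable_covar h.compact_support h.compact_param h.covar_mem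
    (continuousOn_index fun x hx π hπ => (h.contDiffAt_odds hx hπ).continuousAt) h.param_mem
  have hlawR : ∀ᵐ ω ∂Q, ∀ a : Fin k, _ := ae_all_iff.2 fun a =>
    hW.plugInLaw (b := fun x π => x a * dslope (odds Λ) (x ⬝ᵥ π₀) (x ⬝ᵥ π))
      hiCD measurable_covar h.compact_support h.compact_param h.covar_mem
      (ContinuousOn.mul (by fun_prop) (continuousOn_index_dslope h.param_mem
        fun x hx π hπ => h.contDiffAt_odds hx hπ)) h.param_mem
  filter_upwards [hlawG, hlawO, hlawR, h.consistency hW, h.linearization hW,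
    hW.ae_forall h.covar_mem] with ω hωG hωO hωR hcons hlin hωS πhat hmle δ hδ
  have hlim := hcons πhat hmle
  obtain ⟨A, hA, hfoc⟩ := hlin πhat hmle
  replace hωO := hωO πhat (fun n => (hmle n).1) hlim
  replace hωR := fun a => hωR a πhat (fun n => (hmle n).1) hlim
  simp only [dslope_same] at hωR
  set w : ℕ → Obs T k := fun i => W i ω with hw
  set I := infoMatrix μ g Λ π₀ with hI
  set α := ∫ v, G g v ∂μ with hα
  set β := ∫ v, ctrlWeight Λ π₀ v ∂μ with hβ
  set M := Mvec μ g t Λ π₀ with hM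
  set R : ℕ → Fin k → ℝ := fun n a => sampleMean n w fun v =>
    C v * (longDiff g t v - mC) * (covar v a * dslope (odds Λ) (covar v ⬝ᵥ π₀)
      (covar v ⬝ᵥ πhat n)) with hR
  have hα0 : α ≠ 0 := h.G_pos.ne'
  have hβ0 : β ≠ 0 := h.ctrlWeight_pos.ne'
  have ha0 : Tendsto (fun n => sampleMean n w (G g)) atTop (𝓝 α) := hωG
  have hb0 : Tendsto (fun n => sampleMean n w (ctrlWeight Λ (πhat n))) atTop (𝓝 β) := by
    simp only [sampleMean, ctrlWeight_eq, hβ]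
    exact hωO
  -- `R n` is the sensitivity of the control moment to the propensity parameter; its limit is the
  -- numerator of `Mvec`, by `deriv_odds` and C² = C.
  have hRlim : Tendsto R atTop (𝓝 (β • M)) := by
    refine tendsto_pi_nhds.2 fun a => ?_
    have : (β • M) a = ∫ v, C v * (longDiff g t v - mC) *
        (covar v a * deriv (odds Λ) (covar v ⬝ᵥ π₀)) ∂μ := by
      simp only [Pi.smul_apply, smul_eq_mul, hM, Mvec]
      rw [mul_div_cancel₀ _ hβ0]
      refine integral_congr_ae ?_
      filter_upwards [h.covar_mem] with v hv
      rw [h.deriv_odds hv h.param_mem, div_pow, C_sq]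
      ring
    rw [this]
    exact hωR a
  have hdet : I.det ≠ 0 := h.isUnit_det_infoMatrix
  have hdetn : (-I).det ≠ 0 := by
    rw [Matrix.det_neg]
    exact mul_ne_zero (pow_ne_zero _ (by norm_num)) hdet
  have hAinv := tendsto_matrix_inv hA hdetn
  have hAdet : ∀ᶠ n in atTop, (A n).det ≠ 0 :=
    (((Continuous.matrix_det continuous_id).tendsto _).comp hA).eventually_ne hdetn
  have hIinv : (-I)⁻¹ = -I⁻¹ := by
    refine Matrix.inv_eq_right_inv ?_
    rw [neg_mul_neg, Matrix.mul_nonsing_inv _ (isUnit_iff_ne_zero.2 hdet)]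
  -- the coefficients of the linear terms in the remainder
  have hc1 : Tendsto (fun n => (sampleMean n w (G g))⁻¹ - α⁻¹) atTop (𝓝 0) := by
    simpa using (ha0.inv₀ hα0).sub_const α⁻¹
  have hc2 : Tendsto (fun n => β⁻¹ - (sampleMean n w (ctrlWeight Λ (πhat n)))⁻¹) atTop (𝓝 0) := by
    simpa using (hb0.inv₀ hβ0).const_sub β⁻¹
  -- The limit is β⁻¹ (βM)'(-I)⁻¹ + M'I⁻¹ = 0: the correction term in `psiC` is exactly what cancels
  -- the effect of estimating the propensity score.
  have hc3 : Tendsto (fun n => (sampleMean n w (ctrlWeight Λ (πhat n)))⁻¹ • (R n ᵥ* (A n)⁻¹)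
      + M ᵥ* I⁻¹) atTop (𝓝 0) := by
    have hv : Tendsto (fun n => R n ᵥ* (A n)⁻¹) atTop (𝓝 ((β • M) ᵥ* (-I)⁻¹)) :=
      ((Continuous.matrix_vecMul continuous_fst continuous_snd).tendsto
        ((β • M, (-I)⁻¹) : (Fin k → ℝ) × Matrix (Fin k) (Fin k) ℝ)).comp
        (hRlim.prodMk_nhds hAinv)
    have := ((hb0.inv₀ hβ0).smul hv).add_const (M ᵥ* I⁻¹)
    rwa [hIinv, Matrix.smul_vecMul, smul_smul, inv_mul_cancel₀ hβ0, one_smul, Matrix.vecMul_neg,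
      neg_add_cancel] at this
  have hs1 := Metric.tendsto_nhds.1 hc1 δ hδ
  have hs2 := Metric.tendsto_nhds.1 hc2 δ hδ
  have hs3 := eventually_all.2 fun a => Metric.tendsto_nhds.1 (tendsto_pi_nhds.1 hc3 a) δ hδ
  filter_upwards [hs1, hs2, hs3, hfoc, hAdet, ha0.eventually_ne hα0, hb0.eventually_ne hβ0]
    with n h1 h2 h3 hf hAd ha hb
  simp only [Real.dist_eq, Pi.zero_apply, sub_zero] at h1 h2 h3
  set s : Fin k → ℝ := fun a => sampleMean n w fun v => score g Λ π₀ v a with hs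
  have hd : πhat n - π₀ = -((A n)⁻¹ *ᵥ s) := by
    have h4 := congrArg ((A n)⁻¹ *ᵥ ·) hf
    simp only [Matrix.mulVec_add, Matrix.mulVec_mulVec, Matrix.mulVec_zero,
      Matrix.nonsing_inv_mul _ (isUnit_iff_ne_zero.2 hAd), Matrix.one_mulVec] at h4
    exact eq_neg_of_add_eq_zero_right h4
  have hRd : ∑ a, R n a * (πhat n a - π₀ a) = -∑ a, (R n ᵥ* (A n)⁻¹) a * s a := by
    change R n ⬝ᵥ (πhat n - π₀) = -((R n ᵥ* (A n)⁻¹) ⬝ᵥ s)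
    rw [hd, dotProduct_neg, Matrix.dotProduct_mulVec]
  have hG : sampleMean n w (fun v => G g v * longDiff g t v) =
      sampleMean n w (centredG μ g t) + sampleMean n w (G g) * mG := by
    rw [← sampleMean_mul_const, ← sampleMean_add]
    congr 1; ext v; simp only [centredG, hmG]; ring
  -- The long difference is centred at `mC` before the odds are expanded, so that dividing by the
  -- estimated normalization leaves `mC` itself plus small terms.
  have hC : sampleMean n w (fun v => ctrlWeight Λ (πhat n) v * longDiff g t v) =
      sampleMean n w (centredC μ g t Λ π₀) + ∑ a, R n a * (πhat n a - π₀ a)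
        + sampleMean n w (ctrlWeight Λ (πhat n)) * mC := by
    simp only [hR]
    simp_rw [← sampleMean_mul_const]
    rw [← sampleMean_sum, ← sampleMean_add, ← sampleMean_add]
    congr 1; ext v
    simp only [centredC, ctrlWeight_eq, ← hmC]
    have h5 := index_taylor (odds Λ) (covar v) π₀ (πhat n)
    have h6 : ∑ a, C v * (longDiff g t v - mC) * (covar v a *
        dslope (odds Λ) (covar v ⬝ᵥ π₀) (covar v ⬝ᵥ πhat n)) * (πhat n a - π₀ a) =
        C v * (longDiff g t v - mC) * (odds Λ (covar v ⬝ᵥ πhat n) - odds Λ (covar v ⬝ᵥ π₀)) := by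
      rw [h5, add_sub_cancel_left, Finset.mul_sum]
      exact Finset.sum_congr rfl fun a _ => by ring
    rw [h6]
    ring
  have hpsi : sampleMean n w (psi μ g t Λ π₀) = sampleMean n w (centredG μ g t) * α⁻¹
      - sampleMean n w (centredC μ g t Λ π₀) * β⁻¹ - ∑ a, s a * (M ᵥ* I⁻¹) a := by
    have h5 : sampleMean n w (psi μ g t Λ π₀) = sampleMean n w fun v =>
        centredG μ g t v * α⁻¹ - centredC μ g t Λ π₀ v * β⁻¹
          - ∑ a, score g Λ π₀ v a * (M ᵥ* I⁻¹) a :=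
      sampleMean_congr fun i => h.psi_eq t (hωS i)
    rw [h5, sampleMean_sub, sampleMean_sub, sampleMean_sum]
    simp only [sampleMean_mul_const, hs]
  -- An exact identity: each sample mean of centred terms is multiplied by one of the coefficients
  -- shown above to vanish.
  have hrem : attHat g t Λ (πhat n) n w - estimand μ g t Λ π₀ - sampleMean n w (psi μ g t Λ π₀) =
      ((sampleMean n w (G g))⁻¹ - α⁻¹) * sampleMean n w (centredG μ g t)
      + (β⁻¹ - (sampleMean n w (ctrlWeight Λ (πhat n)))⁻¹) * sampleMean n w (centredC μ g t Λ π₀)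
      + ∑ a, ((sampleMean n w (ctrlWeight Λ (πhat n)))⁻¹ • (R n ᵥ* (A n)⁻¹) + M ᵥ* I⁻¹) a
          * s a := by
    simp only [Pi.add_apply, Pi.smul_apply, smul_eq_mul, add_mul, Finset.sum_add_distrib]
    simp_rw [mul_assoc]
    rw [← Finset.mul_sum, attHat_eq, hG, hC, hpsi, hRd, estimand, ← hmG, ← hmC]
    simp_rw [mul_comm (s _)]
    field_simp
    ring
  rw [hrem, remainderScale, mul_add, mul_add, Finset.mul_sum]
  refine (abs_add_le _ _).trans (add_le_add ((abs_add_le _ _).trans (add_le_add ?_ ?_))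
    ((Finset.abs_sum_le_sum_abs _ _).trans (Finset.sum_le_sum fun a _ => ?_)))
  · rw [abs_mul]; exact mul_le_mul_of_nonneg_right h1.le (abs_nonneg _)
  · rw [abs_mul]; exact mul_le_mul_of_nonneg_right h2.le (abs_nonneg _)
  · rw [abs_mul]; exact mul_le_mul_of_nonneg_right (h3 a).le (abs_nonneg _)

end BinaryResponse

end

end DiD

/-! ### Negligibility of the remainder and joint convergence. -/

namespace DiD

noncomputable section

variable {T k : ℕ}

namespace BinaryResponse

variable {μ : Measure (Obs T k)} {g : Period T} {Λ : ℝ → ℝ}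
  {S Θ : Set (Fin k → ℝ)} {π₀ : Fin k → ℝ}
  {Ω' : Type*} [MeasurableSpace Ω'] {Q : Measure Ω'} {W : ℕ → Ω' → Obs T k}

open Classical in
-- `Λ` need not be measurable on the whole line, but it is continuous on the compact set of index
-- values, so it agrees there with a measurable function.
lemma aemeasurable_link (h : BinaryResponse μ g Λ S Θ π₀) {x π : Ω' → Fin k → ℝ}
    (hx : AEMeasurable x Q) (hπ : AEMeasurable π Q) (hxS : ∀ᵐ ω ∂Q, x ω ∈ S)
    (hπΘ : ∀ᵐ ω ∂Q, π ω ∈ Θ) : AEMeasurable (fun ω => Λ (x ω ⬝ᵥ π ω)) Q := by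
  set U : Set ℝ := (fun p : (Fin k → ℝ) × (Fin k → ℝ) => p.1 ⬝ᵥ p.2) '' (S ×ˢ Θ) with hU
  have hdot : Continuous fun p : (Fin k → ℝ) × (Fin k → ℝ) => p.1 ⬝ᵥ p.2 :=
    continuous_fst.dotProduct continuous_snd
  have hUc : IsCompact U := (h.compact_support.prod h.compact_param).image hdot
  have hΛ : ContinuousOn Λ U := by
    rintro u ⟨p, hp, rfl⟩
    exact (h.smooth p.1 hp.1 p.2 hp.2).continuousAt.continuousWithinAt
  have hm : Measurable (U.piecewise Λ 0) :=
    hΛ.measurable_piecewise continuousOn_const hUc.measurableSet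
  refine (hm.comp_aemeasurable (hdot.measurable.comp_aemeasurable (hx.prodMk hπ))).congr ?_
  filter_upwards [hxS, hπΘ] with ω h1 h2
  exact Set.piecewise_eq_of_mem _ _ _ ⟨(x ω, π ω), ⟨h1, h2⟩, rfl⟩

lemma aemeasurable_attHat (h : BinaryResponse μ g Λ S Θ π₀) (hW : IIDSample W Q μ)
    (t : Period T) {π : Ω' → Fin k → ℝ} (hπ : AEMeasurable π Q) (hπΘ : ∀ᵐ ω ∂Q, π ω ∈ Θ)
    (n : ℕ) : AEMeasurable (fun ω => attHat g t Λ (π ω) n (fun i => W i ω)) Q := by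
  have hxS := hW.ae_forall h.covar_mem
  have hlink : ∀ i, AEMeasurable (fun ω => Λ (covar (W i ω) ⬝ᵥ π ω)) Q := fun i =>
    h.aemeasurable_link (measurable_covar.comp_aemeasurable (hW.aemeasurable i)) hπ
      (hxS.mono fun ω hω => hω i) hπΘ
  have hG : ∀ i, AEMeasurable (fun ω => G g (W i ω)) Q := fun i =>
    (measurable_G g).comp_aemeasurable (hW.aemeasurable i)
  have hC : ∀ i, AEMeasurable (fun ω => C (W i ω)) Q := fun i =>
    measurable_C.comp_aemeasurable (hW.aemeasurable i)
  have hD : ∀ i, AEMeasurable (fun ω => longDiff g t (W i ω)) Q := fun i =>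
    (measurable_longDiff g t).comp_aemeasurable (hW.aemeasurable i)
  have hω : ∀ i, AEMeasurable (fun ω => ctrlWeight Λ (π ω) (W i ω)) Q := fun i =>
    ((hlink i).mul (hC i)).div ((hlink i).const_sub 1)
  have hmean : ∀ f : ℕ → Ω' → ℝ, (∀ i, AEMeasurable (f i) Q) →
      AEMeasurable (fun ω => (n : ℝ)⁻¹ * ∑ i ∈ Finset.range n, f i ω) Q := fun f hf =>
    (Finset.aemeasurable_fun_sum _ fun i _ => hf i).const_mul _
  simp_rw [attHat_eq, sampleMean]
  exact ((hmean _ fun i => (hG i).mul (hD i)).div (hmean _ hG)).sub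
    ((hmean _ fun i => (hω i).mul (hD i)).div (hmean _ hω))

/-- Asymptotic linearity of the estimator with estimated propensity score. -/
theorem asymptoticLinearity [IsProbabilityMeasure μ] [IsProbabilityMeasure Q]
    (h : BinaryResponse μ g Λ S Θ π₀) (hW : IIDSample W Q μ) (t : Period T)
    {πhat : ℕ → Ω' → Fin k → ℝ} (hmeas : ∀ n, AEMeasurable (πhat n) Q)
    (hmle : ∀ n, ∀ᵐ ω ∂Q, IsMLE g Λ Θ n (fun i => W i ω) (πhat n ω)) :
    TendstoInMeasure Q
      (fun (n : ℕ) ω =>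
        √n * (attHat g t Λ (πhat n ω) n (fun i => W i ω) - estimand μ g t Λ π₀)
          - 1 / √n * ∑ i ∈ Finset.range n, psi μ g t Λ π₀ (W i ω))
      atTop (fun _ => 0) := by
  have hscale : ∀ (n : ℕ), √n * (n : ℝ)⁻¹ = (√n)⁻¹ := fun n => by
    rcases Nat.eq_zero_or_pos n with rfl | hn
    · simp
    · rw [← div_eq_mul_inv, Real.sqrt_div_self]
  have hb1 := hW.integral_abs_normalizedSum_le (h.memLp_centredG t) (h.integral_centredG t)
  have hb2 := hW.integral_abs_normalizedSum_le (h.memLp_centredC t) (h.integral_centredC t)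
  have hb3 := fun a => hW.integral_abs_normalizedSum_le (h.memLp_score a) (h.integral_score a)
  -- This is √n times `remainderScale`; its summands are normalized sums of centred functions, hence
  -- bounded in L¹ uniformly in `n`.
  set N : ℕ → Ω' → ℝ := fun n ω =>
    |(√n)⁻¹ * ∑ i ∈ Finset.range n, centredG μ g t (W i ω)|
      + |(√n)⁻¹ * ∑ i ∈ Finset.range n, centredC μ g t Λ π₀ (W i ω)|
      + ∑ a, |(√n)⁻¹ * ∑ i ∈ Finset.range n, score g Λ π₀ (W i ω) a| with hN
  have hN12 : ∀ n : ℕ, Integrable (fun ω => |(√n)⁻¹ * ∑ i ∈ Finset.range n, centredG μ g t (W i ω)|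
      + |(√n)⁻¹ * ∑ i ∈ Finset.range n, centredC μ g t Λ π₀ (W i ω)|) Q := fun n =>
    (hb1 n).1.abs.add (hb2 n).1.abs
  have hN3 : ∀ n : ℕ, Integrable
      (fun ω => ∑ a, |(√n)⁻¹ * ∑ i ∈ Finset.range n, score g Λ π₀ (W i ω) a|) Q := fun n =>
    integrable_finsetSum _ fun a _ => (hb3 a n).1.abs
  have hN0 : ∀ n ω, 0 ≤ N n ω := fun n ω => by positivity
  refine tendstoInMeasure_zero_of_small_mul (N := N) (K := (1 + ∫ w, centredG μ g t w ^ 2 ∂μ)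
    + (1 + ∫ w, centredC μ g t Λ π₀ w ^ 2 ∂μ) + ∑ a, (1 + ∫ w, score g Λ π₀ w a ^ 2 ∂μ))
    (fun n => ?_) hN0 (fun n => (hN12 n).add (hN3 n)) (fun n => ?_) ?_
  · have h1 := h.aemeasurable_attHat hW t (hmeas n) ((hmle n).mono fun ω hω => hω.1) n
    have h2 : ∀ i, AEMeasurable (fun ω => psi μ g t Λ π₀ (W i ω)) Q := fun i =>
      (hW.identDistrib (h.memLp_psi t).1.aemeasurable i).aemeasurable_fst
    exact ((h1.sub_const _).const_mul _).sub
      ((Finset.aemeasurable_fun_sum _ fun i _ => h2 i).const_mul _)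
  · simp only [hN]
    rw [integral_add (hN12 n) (hN3 n), integral_add (hb1 n).1.abs (hb2 n).1.abs,
      integral_finsetSum _ fun a _ => (hb3 a n).1.abs]
    exact add_le_add (add_le_add (hb1 n).2 (hb2 n).2)
      (Finset.sum_le_sum fun a _ => (hb3 a n).2)
  · filter_upwards [h.remainder_le hW t, ae_all_iff.2 hmle] with ω hω hω' δ hδ
    filter_upwards [hω (fun n => πhat n ω) hω' δ hδ] with n hn
    have hsm : ∀ f : Obs T k → ℝ, √n * sampleMean n (fun i => W i ω) f =
        (√n)⁻¹ * ∑ i ∈ Finset.range n, f (W i ω) := fun f => by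
      rw [sampleMean, ← mul_assoc, hscale]
    have hNeq : N n ω = √n * remainderScale μ g t Λ π₀ n (fun i => W i ω) := by
      have habs : ∀ f : Obs T k → ℝ, |(√n)⁻¹ * ∑ i ∈ Finset.range n, f (W i ω)| =
          √n * |sampleMean n (fun i => W i ω) f| := fun f => by
        rw [← hsm, abs_mul, abs_of_nonneg (Real.sqrt_nonneg _)]
      rw [remainderScale, mul_add, mul_add, Finset.mul_sum]
      exact congrArg₂ (· + ·) (congrArg₂ (· + ·) (habs _) (habs _))
        (Finset.sum_congr rfl fun a _ => habs fun v => score g Λ π₀ v a)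
    have hfeq : √n * (attHat g t Λ (πhat n ω) n (fun i => W i ω) - estimand μ g t Λ π₀)
          - 1 / √n * ∑ i ∈ Finset.range n, psi μ g t Λ π₀ (W i ω) =
        √n * (attHat g t Λ (πhat n ω) n (fun i => W i ω) - estimand μ g t Λ π₀
          - sampleMean n (fun i => W i ω) (psi μ g t Λ π₀)) := by
      rw [mul_sub √n (attHat g t Λ (πhat n ω) n (fun i => W i ω) - estimand μ g t Λ π₀), hsm,
        one_div]
    rw [hfeq, abs_mul, abs_of_nonneg (Real.sqrt_nonneg _), mul_add, hNeq]
    have := mul_le_mul_of_nonneg_left hn (Real.sqrt_nonneg n)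
    nlinarith

end BinaryResponse

/-- Joint asymptotic normality of asymptotically linear estimators. -/
theorem tendstoInDistribution_of_asymptoticallyLinear {α Ω' ι : Type*} [MeasurableSpace α]
    [MeasurableSpace Ω'] [Fintype ι] [DecidableEq ι] {W : ℕ → Ω' → α} {Q : Measure Ω'}
    {μ : Measure α} [IsProbabilityMeasure Q] [IsProbabilityMeasure μ] (hW : IIDSample W Q μ)
    {z : ι → α → ℝ} (hz : ∀ q, MemLp (z q) 2 μ) (h0 : ∀ q, ∫ w, z q w ∂μ = 0)
    {Y : ι → ℕ → Ω' → ℝ} (hY : ∀ q n, AEMeasurable (Y q n) Q)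
    (hlin : ∀ q, TendstoInMeasure Q
      (fun (n : ℕ) ω => Y q n ω - 1 / √n * ∑ i ∈ Finset.range n, z q (W i ω)) atTop
      (fun _ => 0)) :
    TendstoInDistribution
      (fun (n : ℕ) ω => (WithLp.toLp 2 (fun q => Y q n ω) : EuclideanSpace ℝ ι))
      atTop (id : EuclideanSpace ℝ ι → EuclideanSpace ℝ ι) (fun _ => Q)
      (multivariateGaussian 0 (Matrix.of fun q r => ∫ w, z q w * z r w ∂μ)) := by
  refine tendstoInDistribution_of_tendstoInMeasure_sub _ _ (hW.centralLimit hz h0) ?_ fun n =>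
    (WithLp.measurable_toLp 2 (ι → ℝ)).comp_aemeasurable (aemeasurable_pi_lambda _ fun q => hY q n)
  simp only [tendstoInMeasure_iff_measureReal_norm, sub_zero, one_div] at hlin
  rw [tendstoInMeasure_iff_measureReal_norm]
  intro ε hε
  -- If every coordinate error is below ε/(card ι + 1), the Euclidean norm, at most the sum of the
  -- errors, is below ε. The added 1 covers an empty index set and makes the inequality strict.
  have hc : (0 : ℝ) < Fintype.card ι + 1 := by positivity
  have hsum := tendsto_finsetSum Finset.univ fun q _ =>
    hlin q (ε / (Fintype.card ι + 1)) (by positivity)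
  rw [Finset.sum_const_zero] at hsum
  refine squeeze_zero (fun _ => measureReal_nonneg) (fun n => ?_) hsum
  refine (measureReal_mono ?_ (measure_ne_top _ _)).trans (measureReal_biUnion_finset_le Finset.univ _)
  intro ω hω
  by_contra hcon
  simp only [Finset.mem_univ, Set.iUnion_true, Set.mem_iUnion, Set.mem_ofPred_eq, not_exists,
    not_le] at hcon
  have hle : ‖(WithLp.toLp 2 (fun q => Y q n ω) : EuclideanSpace ℝ ι)
      - WithLp.toLp 2 (fun q => (√n)⁻¹ * ∑ i ∈ Finset.range n, z q (W i ω))‖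
      ≤ ∑ q, ‖Y q n ω - (√n)⁻¹ * ∑ i ∈ Finset.range n, z q (W i ω)‖ := by
    rw [EuclideanSpace.norm_eq]
    refine Real.sqrt_le_iff.2 ⟨by positivity, ?_⟩
    exact Finset.sum_sq_le_sq_sum_of_nonneg fun q _ => norm_nonneg _
  have hlt : ∑ q : ι, ‖Y q n ω - (√n)⁻¹ * ∑ i ∈ Finset.range n, z q (W i ω)‖ < ε := by
    refine (Finset.sum_le_sum fun q _ => (hcon q).le).trans_lt ?_
    rw [Finset.sum_const, Finset.card_univ, nsmul_eq_mul, ← mul_div_assoc, div_lt_iff₀ hc]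
    nlinarith
  have hω' : ε ≤ ‖(WithLp.toLp 2 (fun q => Y q n ω) : EuclideanSpace ℝ ι)
      - WithLp.toLp 2 (fun q => (√n)⁻¹ * ∑ i ∈ Finset.range n, z q (W i ω))‖ := by
    simpa using hω
  linarith

end

end DiD

namespace DiD

noncomputable section

/-! ### Conditioning on an indicator -/

lemma indicator_eq_mul {Ω : Type*} {e : Ω → ℝ} (h01 : ∀ ω, e ω = 0 ∨ e ω = 1) (f : Ω → ℝ) :
    {ω | e ω = 1}.indicator f = fun ω => e ω * f ω := by
  ext ω
  rcases h01 ω with h | h <;> simp [Set.indicator, h]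

section Cond

variable {Ω : Type*} [MeasurableSpace Ω] {P : Measure Ω} [IsFiniteMeasure P] {e : Ω → ℝ}

lemma measurableSet_eq_one (he : Measurable e) : MeasurableSet {ω | e ω = 1} :=
  he (measurableSet_singleton 1)

lemma ae_cond_iff (he : Measurable e) {p : Ω → Prop} :
    (∀ᵐ ω ∂(ProbabilityTheory.cond P {ω | e ω = 1}), p ω) ↔ ∀ᵐ ω ∂P, e ω = 1 → p ω := by
  rw [ProbabilityTheory.cond, Measure.ae_ennreal_smul_measure_iff
    (ENNReal.inv_ne_zero.2 (measure_ne_top P _)), ae_restrict_iff' (measurableSet_eq_one he)]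
  rfl

lemma integrable_cond_iff (he : Measurable e) (h01 : ∀ ω, e ω = 0 ∨ e ω = 1) {f : Ω → ℝ} :
    Integrable f (ProbabilityTheory.cond P {ω | e ω = 1}) ↔
      Integrable (fun ω => e ω * f ω) P := by
  rw [← indicator_eq_mul h01, integrable_indicator_iff (measurableSet_eq_one he)]
  by_cases h0 : P {ω | e ω = 1} = 0
  · rw [ProbabilityTheory.cond_eq_zero_of_meas_eq_zero h0, IntegrableOn,
      Measure.restrict_eq_zero.2 h0]
  · rw [ProbabilityTheory.cond, integrable_smul_measure
      (ENNReal.inv_ne_zero.2 (measure_ne_top P _)) (ENNReal.inv_ne_top.2 h0), IntegrableOn]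

/-- Multiplying by the probability instead of dividing keeps the identity valid for a null event,
where both sides vanish. -/
lemma integral_cond_mul (he : Measurable e) (h01 : ∀ ω, e ω = 0 ∨ e ω = 1) (f : Ω → ℝ) :
    P.real {ω | e ω = 1} * ∫ ω, f ω ∂(ProbabilityTheory.cond P {ω | e ω = 1}) =
      ∫ ω, e ω * f ω ∂P := by
  have h1 : ∫ ω, e ω * f ω ∂P = ∫ ω in {ω | e ω = 1}, f ω ∂P := by
    rw [← integral_indicator (measurableSet_eq_one he), indicator_eq_mul h01]
  rw [h1]
  by_cases h0 : P {ω | e ω = 1} = 0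
  · rw [Measure.restrict_eq_zero.2 h0, measureReal_def, h0]
    simp
  · rw [ProbabilityTheory.cond, integral_smul_measure, smul_eq_mul, ENNReal.toReal_inv,
      ← mul_assoc, measureReal_def, mul_inv_cancel₀ (ENNReal.toReal_ne_zero.2
        ⟨h0, measure_ne_top P _⟩), one_mul]

end Cond

/-- Integrating against a function that is measurable for the conditioning σ-algebra. -/
lemma integral_mul_condExp {Ω : Type*} {m m₀ : MeasurableSpace Ω} {ν : Measure Ω}
    [IsFiniteMeasure ν] (hm : m ≤ m₀) {f Y : Ω → ℝ} (hf : StronglyMeasurable[m] f)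
    (hY : Integrable Y ν) (hfY : Integrable (fun ω => f ω * Y ω) ν) :
    ∫ ω, f ω * Y ω ∂ν = ∫ ω, f ω * condExp m ν Y ω ∂ν := by
  have h1 := condExp_mul_of_stronglyMeasurable_left hf hfY hY
  rw [← integral_condExp hm (f := fun ω => f ω * Y ω)]
  exact integral_congr_ae h1

lemma integrable_bdd_mul {Ω : Type*} [MeasurableSpace Ω] {P : Measure Ω} {f b : Ω → ℝ}
    (hf : Integrable f P) (hb : Measurable b) {B : ℝ} (hB : ∀ ω, |b ω| ≤ B) :
    Integrable (fun ω => b ω * f ω) P := by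
  refine Integrable.mono' (hf.norm.const_mul B) (hb.aestronglyMeasurable.mul hf.1)
    (ae_of_all _ fun ω => ?_)
  rw [norm_mul]
  exact mul_le_mul_of_nonneg_right (hB ω) (norm_nonneg _)

/-! ### Identification -/

namespace Population

variable {T k : ℕ} {Ω : Type*} [MeasurableSpace Ω] {P : Measure Ω}
  {pop : Population T k Ω} {g : Period T} {Λ : ℝ → ℝ} {Θ : Set (Fin k → ℝ)} {π₀ : Fin k → ℝ}

lemma measurable_Y (pop : Population T k Ω) (t : Period T) : Measurable (pop.Y t) := by
  unfold Y
  exact Measurable.ite (pop.measurable_D t (measurableSet_singleton true)) (pop.measurable_Y1 t)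
    (pop.measurable_Y0 t)

lemma measurable_obs (pop : Population T k Ω) : Measurable pop.obs :=
  (measurable_pi_lambda _ fun t => pop.measurable_Y t).prodMk
    (pop.measurable_X.prodMk (measurable_pi_lambda _ fun t => pop.measurable_D t))

lemma mem_support_X (pop : Population T k Ω) : ∀ᵐ ω ∂P, pop.X ω ∈ (P.map pop.X).support :=
  ae_of_ae_map pop.measurable_X.aemeasurable Measure.support_mem_ae

lemma ae_covar_mem_support (pop : Population T k Ω) :
    ∀ᵐ w ∂(pop.law P), covar w ∈ (P.map pop.X).support := by
  rw [law, ae_map_iff pop.measurable_obs.aemeasurable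
    (measurable_covar Measure.isClosed_support.measurableSet)]
  exact pop.mem_support_X

lemma PScoreModel.isCompact_support (hm : pop.PScoreModel P g Λ Θ π₀) :
    IsCompact (P.map pop.X).support := by
  obtain ⟨S, hS, hsub⟩ := hm.support
  exact hS.of_isClosed_subset Measure.isClosed_support hsub

open Classical in
/-- A bounded measurable version of the propensity score. -/
lemma PScoreModel.exists_pscore_version (hm : pop.PScoreModel P g Λ Θ π₀) :
    ∃ p : (Fin k → ℝ) → ℝ, Measurable p ∧ (∀ x, |p x| ≤ 1) ∧
      ∀ x ∈ (P.map pop.X).support, p x = Λ (x ⬝ᵥ π₀) := by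
  set S := (P.map pop.X).support
  have hπ₀ : π₀ ∈ Θ := interior_subset hm.interior
  have hc : ContinuousOn (fun x : Fin k → ℝ => Λ (x ⬝ᵥ π₀)) S :=
    BinaryResponse.continuousOn_index_right hπ₀ fun x hx π hπ =>
      (hm.smooth _ ⟨x, hx, π, hπ, rfl⟩).continuousAt
  refine ⟨S.piecewise (fun x => Λ (x ⬝ᵥ π₀)) 0, hc.measurable_piecewise continuousOn_const
    hm.isCompact_support.measurableSet, fun x => ?_, fun x hx => by simp [hx]⟩
  by_cases hx : x ∈ S
  · have := hm.range (x ⬝ᵥ π₀)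
    simp only [hx, Set.piecewise_eq_of_mem]
    rw [abs_of_nonneg this.1]
    exact this.2
  · simp [hx]

variable [IsProbabilityMeasure P]

instance (pop : Population T k Ω) : IsProbabilityMeasure (pop.law P) :=
  Measure.isProbabilityMeasure_map pop.measurable_obs.aemeasurable

lemma sigmaX_le (pop : Population T k Ω) : pop.sigmaX ≤ ‹MeasurableSpace Ω› :=
  pop.measurable_X.comap_le

lemma measurable_G_obs (pop : Population T k Ω) (g : Period T) :
    Measurable fun ω => G g (pop.obs ω) := (measurable_G g).comp pop.measurable_obs

lemma measurable_C_obs (pop : Population T k Ω) : Measurable fun ω => C (pop.obs ω) :=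
  measurable_C.comp pop.measurable_obs

lemma G_zero_or_one (g : Period T) (w : Obs T k) : G g w = 0 ∨ G g w = 1 := by
  rcases G_C_cases g w with h | h | h <;> simp [h.1]

lemma C_zero_or_one (w : Obs T k) : C w = 0 ∨ C w = 1 := by
  unfold C; split <;> simp

lemma G_add_C_zero_or_one (g : Period T) (w : Obs T k) : G g w + C w = 0 ∨ G g w + C w = 1 := by
  rcases G_C_cases g w with h | h | h <;> simp [h.1, h.2]

lemma covar_obs (pop : Population T k Ω) (ω : Ω) : covar (pop.obs ω) = pop.X ω := rfl

/-- Iterated expectations for the generalized propensity score. -/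
lemma integral_G_mul {p : Ω → ℝ}
    (hp : pop.pscore P g =ᵐ[ProbabilityTheory.cond P (pop.evGC g)] p) {f : Ω → ℝ}
    (hf : StronglyMeasurable[pop.sigmaX] f)
    (hint : Integrable (fun ω => (G g (pop.obs ω) + C (pop.obs ω)) * f ω) P) :
    ∫ ω, G g (pop.obs ω) * f ω ∂P =
      ∫ ω, (G g (pop.obs ω) + C (pop.obs ω)) * (p ω * f ω) ∂P := by
  have he : Measurable fun ω => G g (pop.obs ω) + C (pop.obs ω) :=
    (pop.measurable_G_obs g).add pop.measurable_C_obs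
  have h01 := fun ω => G_add_C_zero_or_one g (pop.obs ω)
  set ν := ProbabilityTheory.cond P (pop.evGC g) with hν
  have hfν : Integrable f ν := (integrable_cond_iff he h01).2 hint
  have hGν : Integrable (fun ω => G g (pop.obs ω)) ν :=
    Integrable.of_bound (pop.measurable_G_obs g).aestronglyMeasurable 1
      (ae_of_all _ fun ω => norm_G_le g _)
  have hfG : Integrable (fun ω => f ω * G g (pop.obs ω)) ν := by
    simpa only [mul_comm] using integrable_bdd_mul hfν (pop.measurable_G_obs g)
      (B := 1) fun ω => norm_G_le g (pop.obs ω)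
  have h1 := integral_mul_condExp pop.sigmaX_le hf hGν hfG
  have h2 : ∫ ω, f ω * condExp pop.sigmaX ν (fun ω => G g (pop.obs ω)) ω ∂ν =
      ∫ ω, p ω * f ω ∂ν := by
    refine integral_congr_ae ?_
    filter_upwards [hp] with ω hω
    rw [← hω, mul_comm]
    rfl
  have h3 := integral_cond_mul (P := P) he h01 fun ω => f ω * G g (pop.obs ω)
  have h4 := integral_cond_mul (P := P) he h01 fun ω => p ω * f ω
  rw [← h4]
  -- Since G C = 0 and G² = G, inserting the factor G + C into G f changes nothing.
  refine Eq.trans ?_ (h3.symm.trans (congrArg _ (h1.trans h2)))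
  refine integral_congr_ae (ae_of_all _ fun ω => ?_)
  rcases G_C_cases g (pop.obs ω) with h | h | h <;> simp [h.1, h.2]

/-- The law of the observed vector follows the binary response model. -/
lemma PScoreModel.binaryResponse (hm : pop.PScoreModel P g Λ Θ π₀) (hG : 0 < P (pop.evG g))
    (hmoment : ∀ t : Period T, MemLp (pop.Y t) 2 P) :
    BinaryResponse (pop.law P) g Λ (P.map pop.X).support Θ π₀ := by
  set S := (P.map pop.X).support with hS
  obtain ⟨p, hp, hp1, hpS⟩ := hm.exists_pscore_version
  have hidx : ∀ x ∈ S, ∀ π ∈ Θ, x ⬝ᵥ π ∈ pop.indexSet P Θ := fun x hx π hπ =>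
    ⟨x, hx, π, hπ, rfl⟩
  have hmap : ∀ f : Obs T k → ℝ, Measurable f →
      ∫ w, f w ∂(pop.law P) = ∫ ω, f (pop.obs ω) ∂P := fun f hf =>
    integral_map pop.measurable_obs.aemeasurable hf.aestronglyMeasurable
  have he : Measurable fun ω => G g (pop.obs ω) + C (pop.obs ω) :=
    (pop.measurable_G_obs g).add pop.measurable_C_obs
  have h01 := fun ω => G_add_C_zero_or_one g (pop.obs ω)
  have hEG : ∫ w, G g w ∂(pop.law P) = P.real (pop.evG g) := by
    rw [hmap _ (measurable_G g)]
    have : (fun ω => G g (pop.obs ω)) = (pop.evG g).indicator fun _ => (1 : ℝ) := by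
      rw [evG, indicator_eq_mul fun ω => G_zero_or_one g (pop.obs ω)]
      simp
    rw [this]
    exact integral_indicator_one (measurableSet_eq_one (pop.measurable_G_obs g))
  have hGpos : 0 < P.real (pop.evG g) := ENNReal.toReal_pos hG.ne' (measure_ne_top P _)
  have hpp : pop.pscore P g =ᵐ[ProbabilityTheory.cond P (pop.evGC g)] fun ω => p (pop.X ω) := by
    have hXS : ∀ᵐ ω ∂(ProbabilityTheory.cond P (pop.evGC g)), pop.X ω ∈ S :=
      ProbabilityTheory.cond_absolutelyContinuous.ae_le pop.mem_support_X
    filter_upwards [hm.correct, hXS] with ω h1 h2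
    rw [h1, hpS _ h2]
  refine
    { compact_support := hm.isCompact_support
      compact_param := hm.compact
      interior := hm.interior
      covar_mem := pop.ae_covar_mem_support
      pos := fun x hx π hπ => ?_
      lt_one := fun x hx π hπ => ?_
      inj := fun x hx π hπ π' hπ' h => hm.strictMono.injOn (hidx x hx π hπ) (hidx x hx π' hπ') h
      smooth := fun x hx π hπ => hm.smooth _ (hidx x hx π hπ)
      deriv_pos := fun x hx π hπ => ?_
      balance := fun f hf ⟨B, hB⟩ => ?_
      posDef := fun v hv => ?_
      G_pos := hEG ▸ hGpos
      moment := fun t => ?_ }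
  · obtain ⟨ε, hε, h1⟩ := hm.bounds _ (hidx x hx π hπ)
    exact hε.trans_le h1.1
  · obtain ⟨ε, hε, h1⟩ := hm.bounds _ (hidx x hx π hπ)
    linarith [h1.2]
  · obtain ⟨c, M, hc, h1⟩ := hm.deriv_bounds
    exact hc.trans_le (h1 _ (hidx x hx π hπ)).1
  · have h1 : ∫ w, (G g w + C w) * (Λ (covar w ⬝ᵥ π₀) * f (covar w)) ∂(pop.law P) =
        ∫ w, (G g w + C w) * (p (covar w) * f (covar w)) ∂(pop.law P) := by
      refine integral_congr_ae ?_
      filter_upwards [pop.ae_covar_mem_support (P := P)] with w hw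
      rw [hpS _ hw]
    rw [h1, hmap (fun w => G g w * f (covar w)) ((measurable_G g).mul (hf.comp measurable_covar)),
      hmap (fun w => (G g w + C w) * (p (covar w) * f (covar w)))
        (((measurable_G g).add measurable_C).mul ((hp.comp measurable_covar).mul (hf.comp measurable_covar)))]
    refine integral_G_mul hpp (f := fun ω => f (pop.X ω)) ?_ ?_
    · exact (hf.comp (comap_measurable pop.X)).stronglyMeasurable
    · refine Integrable.of_bound (he.mul (hf.comp pop.measurable_X)).aestronglyMeasurable B
        (ae_of_all _ fun ω => ?_)
      rw [norm_mul]
      refine (mul_le_of_le_one_left (norm_nonneg _) ?_).trans (hB _)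
      rcases h01 ω with h | h <;> simp [h]
  · have h1 := hm.posDef.dotProduct_mulVec_pos hv
    -- The event G = 1 lies in G + C = 1, so positive definiteness under the conditional law passes
    -- to the unnormalized moments.
    have hGC : 0 < P.real (pop.evGC g) := by
      refine hGpos.trans_le (measureReal_mono fun ω hω => ?_)
      have hω' : G g (pop.obs ω) = 1 := hω
      have : C (pop.obs ω) = 0 := by
        rcases G_C_cases g (pop.obs ω) with h | h | h
        · exact h.2
        · simp [h.1] at hω'
        · exact h.2
      simp [evGC, hω', this]
    rw [hmap (fun w => (G g w + C w) * (covar w ⬝ᵥ v) ^ 2)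
      (((measurable_G g).add measurable_C).mul (((continuous_id.dotProduct continuous_const).measurable.comp measurable_covar).pow_const 2))]
    have h2 := integral_cond_mul (P := P) he h01 fun ω => (covar (pop.obs ω) ⬝ᵥ v) ^ 2
    rw [← h2]
    refine mul_pos hGC ?_
    have h3 : ∀ a b, Integrable (fun ω => pop.X ω a * pop.X ω b)
        (ProbabilityTheory.cond P (pop.evGC g)) := fun a b => by
      obtain ⟨B, hB⟩ := hm.isCompact_support.exists_bound_of_continuousOn
        (f := fun x : Fin k → ℝ => x a * x b) (by fun_prop)
      refine Integrable.of_bound (((measurable_pi_apply a).comp pop.measurable_X).mul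
        ((measurable_pi_apply b).comp pop.measurable_X)).aestronglyMeasurable B ?_
      filter_upwards [ProbabilityTheory.cond_absolutelyContinuous.ae_le
        (pop.mem_support_X (P := P))] with ω hω using hB _ hω
    have h4 : ∀ ω, (covar (pop.obs ω) ⬝ᵥ v) ^ 2 =
        ∑ a, ∑ b, v a * (pop.X ω a * pop.X ω b * v b) := fun ω => by
      rw [covar_obs, sq, dotProduct, Finset.sum_mul_sum]
      exact Finset.sum_congr rfl fun a _ => Finset.sum_congr rfl fun b _ => by ring
    simp_rw [h4]
    change 0 < ∫ ω, _ ∂(ProbabilityTheory.cond P (pop.evGC g))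
    rw [integral_finsetSum _ fun a _ => integrable_finsetSum _ fun b _ =>
      ((h3 a b).mul_const _).const_mul _]
    refine h1.trans_eq ?_
    simp only [star_trivial, dotProduct, Matrix.mulVec, Finset.mul_sum, Matrix.of_apply]
    refine Finset.sum_congr rfl fun a _ => ?_
    rw [integral_finsetSum _ fun b _ => ((h3 a b).mul_const _).const_mul _]
    refine Finset.sum_congr rfl fun b _ => ?_
    rw [integral_const_mul, integral_mul_const]
  · exact (memLp_map_measure_iff (measurable_outcome t).aestronglyMeasurable
      pop.measurable_obs.aemeasurable).2 (hmoment t)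

end Population

end

end DiD

/-! ### Identification of ATT(g,t) by reweighting and telescoping. -/

namespace DiD

noncomputable section

namespace Population

variable {T k : ℕ} {Ω : Type*} [MeasurableSpace Ω] {P : Measure Ω}
  {pop : Population T k Ω} {g : Period T} {Λ : ℝ → ℝ} {Θ : Set (Fin k → ℝ)} {π₀ : Fin k → ℝ}

/-- Reweighting the never treated: conditional mean equality of `D` given the covariates turns the
mean of `D` over group `g` into a weighted mean over the never treated. -/
lemma integral_G_eq_integral_C [IsProbabilityMeasure P]
    {p : (Fin k → ℝ) → ℝ} (hp : Measurable p) (hp1 : ∀ x, |p x| ≤ 1)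
    (hps : pop.pscore P g =ᵐ[ProbabilityTheory.cond P (pop.evGC g)] fun ω => p (pop.X ω))
    {ρ : (Fin k → ℝ) → ℝ} (hρ : Measurable ρ) (hρB : ∃ B, ∀ x, |ρ x| ≤ B)
    (hρp : ∀ᵐ ω ∂P, (1 - p (pop.X ω)) * ρ (pop.X ω) = p (pop.X ω))
    {D : Ω → ℝ} (hCD : Integrable (fun ω => C (pop.obs ω) * D ω) P)
    (heq : condExp pop.sigmaX (ProbabilityTheory.cond P (pop.evG g)) D
      =ᵐ[ProbabilityTheory.cond P (pop.evG g)]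
      condExp pop.sigmaX (ProbabilityTheory.cond P pop.evC) D) :
    ∫ ω, G g (pop.obs ω) * D ω ∂P = ∫ ω, C (pop.obs ω) * (ρ (pop.X ω) * D ω) ∂P := by
  obtain ⟨B, hB⟩ := hρB
  have hGm := pop.measurable_G_obs g
  have hCm := pop.measurable_C_obs
  have hG01 := fun ω => G_zero_or_one g (pop.obs ω)
  have hC01 := fun ω => C_zero_or_one (pop.obs ω)
  have hXm : Measurable[pop.sigmaX] pop.X := comap_measurable pop.X
  set νG := ProbabilityTheory.cond P (pop.evG g)
  set νC := ProbabilityTheory.cond P pop.evC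
  set m₁ := condExp pop.sigmaX νG D with hm₁
  set m₂ := condExp pop.sigmaX νC D with hm₂
  have hsm : StronglyMeasurable[pop.sigmaX] m₂ := stronglyMeasurable_condExp
  have h12 : ∀ᵐ ω ∂P, G g (pop.obs ω) = 1 → m₁ ω = m₂ ω := (ae_cond_iff hGm).1 heq
  have h12' : (fun ω => G g (pop.obs ω) * m₁ ω) =ᵐ[P] fun ω => G g (pop.obs ω) * m₂ ω := by
    filter_upwards [h12] with ω hω
    rcases hG01 ω with h | h
    · rw [h, zero_mul, zero_mul]
    · rw [hω h]
  -- `m₂` is a conditional mean under the law of the never treated; its integrability over group `g`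
  -- comes from its agreement there with `m₁`.
  have hG₂ : Integrable (fun ω => G g (pop.obs ω) * m₂ ω) P :=
    ((integrable_cond_iff hGm hG01).1 integrable_condExp).congr h12'
  have hC₂ : Integrable (fun ω => C (pop.obs ω) * m₂ ω) P :=
    (integrable_cond_iff hCm hC01).1 integrable_condExp
  have hGC₂ : Integrable (fun ω => (G g (pop.obs ω) + C (pop.obs ω)) * m₂ ω) P := by
    refine (hG₂.add hC₂).congr (ae_of_all _ fun ω => ?_)
    simp only [Pi.add_apply]; ring
  have hρX : Measurable fun ω => ρ (pop.X ω) := hρ.comp pop.measurable_X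
  have hpX : Measurable fun ω => p (pop.X ω) := hp.comp pop.measurable_X
  have hbm : ∀ {f : Ω → ℝ}, Integrable f P → Integrable (fun ω => ρ (pop.X ω) * f ω) P :=
    fun hf => integrable_bdd_mul hf hρX fun ω => hB _
  have hbp : ∀ {f : Ω → ℝ}, Integrable f P → Integrable (fun ω => p (pop.X ω) * f ω) P :=
    fun hf => integrable_bdd_mul hf hpX fun ω => hp1 _
  -- the mean over group `g`
  have e1 : ∫ ω, G g (pop.obs ω) * D ω ∂P = ∫ ω, G g (pop.obs ω) * m₂ ω ∂P := by
    rw [← integral_congr_ae h12', ← integral_cond_mul hGm hG01, ← integral_cond_mul hGm hG01]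
    exact congrArg _ (integral_condExp pop.sigmaX_le).symm
  have e2 : ∫ ω, G g (pop.obs ω) * m₂ ω ∂P =
      ∫ ω, (G g (pop.obs ω) + C (pop.obs ω)) * (p (pop.X ω) * m₂ ω) ∂P :=
    integral_G_mul hps hsm hGC₂
  -- the weighted mean over the never treated
  have hρs : StronglyMeasurable[pop.sigmaX] fun ω => ρ (pop.X ω) :=
    (hρ.comp hXm).stronglyMeasurable
  have e3 : ∫ ω, C (pop.obs ω) * (ρ (pop.X ω) * D ω) ∂P =
      ∫ ω, C (pop.obs ω) * (ρ (pop.X ω) * m₂ ω) ∂P := by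
    rw [← integral_cond_mul hCm hC01, ← integral_cond_mul hCm hC01]
    have hDν : Integrable D νC := (integrable_cond_iff hCm hC01).2 hCD
    exact congrArg _ (integral_mul_condExp pop.sigmaX_le hρs hDν
      (integrable_bdd_mul hDν hρX fun ω => hB _))
  have hρGC : Integrable (fun ω => (G g (pop.obs ω) + C (pop.obs ω)) *
      (ρ (pop.X ω) * m₂ ω)) P :=
    (hbm hGC₂).congr (ae_of_all _ fun ω => mul_left_comm _ _ _)
  have hρG : Integrable (fun ω => G g (pop.obs ω) * (ρ (pop.X ω) * m₂ ω)) P :=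
    (hbm hG₂).congr (ae_of_all _ fun ω => mul_left_comm _ _ _)
  have hpρ : Integrable (fun ω => (G g (pop.obs ω) + C (pop.obs ω)) *
      (p (pop.X ω) * (ρ (pop.X ω) * m₂ ω))) P :=
    (hbp hρGC).congr (ae_of_all _ fun ω => mul_left_comm _ _ _)
  have e4 : ∫ ω, G g (pop.obs ω) * (ρ (pop.X ω) * m₂ ω) ∂P =
      ∫ ω, (G g (pop.obs ω) + C (pop.obs ω)) * (p (pop.X ω) * (ρ (pop.X ω) * m₂ ω)) ∂P :=
    integral_G_mul hps (hρs.mul hsm) hρGC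
  -- With C = (G + C) - G, the integrand becomes (G + C)(1 - p) ρ m₂, and (1 - p) ρ = p.
  have e5 : ∫ ω, C (pop.obs ω) * (ρ (pop.X ω) * m₂ ω) ∂P =
      ∫ ω, (G g (pop.obs ω) + C (pop.obs ω)) * (p (pop.X ω) * m₂ ω) ∂P := by
    have : ∫ ω, C (pop.obs ω) * (ρ (pop.X ω) * m₂ ω) ∂P =
        ∫ ω, (G g (pop.obs ω) + C (pop.obs ω)) * (ρ (pop.X ω) * m₂ ω) ∂P
          - ∫ ω, G g (pop.obs ω) * (ρ (pop.X ω) * m₂ ω) ∂P := by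
      rw [← integral_sub hρGC hρG]
      congr 1; ext ω; ring
    rw [this, e4, ← integral_sub hρGC hpρ]
    refine integral_congr_ae ?_
    filter_upwards [hρp] with ω hω
    linear_combination (G g (pop.obs ω) + C (pop.obs ω)) * m₂ ω * hω
  rw [e1, e2, e3, e5]

lemma treat_obs (pop : Population T k Ω) (s : Period T) (ω : Ω) :
    treat s (pop.obs ω) = pop.D s ω := rfl

lemma Y_eq_Y0_of_C (pop : Population T k Ω) {ω : Ω} (h : C (pop.obs ω) = 1) (s : Period T) :
    pop.Y s ω = pop.Y0 s ω := by
  have hs : ∀ s, treat s (pop.obs ω) = false := by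
    by_contra hc
    rw [C, if_neg hc] at h
    exact zero_ne_one h
  have := hs s
  rw [treat_obs] at this
  simp [Y, this]

lemma treat_of_G (pop : Population T k Ω) {ω : Ω} (h : G g (pop.obs ω) = 1) :
    pop.D g ω = true ∧ ∀ s, s < g → pop.D s ω = false := by
  have h' : treat g (pop.obs ω) = true ∧ ∀ s, s < g → treat s (pop.obs ω) = false := by
    by_contra hc
    rw [G, if_neg hc] at h
    exact zero_ne_one h
  exact h'

lemma Y_eq_Y0_of_G (pop : Population T k Ω) {ω : Ω} (h : G g (pop.obs ω) = 1) {s : Period T}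
    (hs : s < g) : pop.Y s ω = pop.Y0 s ω := by
  simp [Y, (pop.treat_of_G h).2 s hs]

lemma coe_prev {s : Period T} (hs : 2 ≤ (s : ℕ)) : ((prev s : Period T) : ℕ) = s - 1 := by
  rw [prev, dif_pos hs]

lemma Irreversible.ae_treated (h : pop.Irreversible P) (hg : 2 ≤ (g : ℕ)) :
    ∀ᵐ ω ∂P, G g (pop.obs ω) = 1 → ∀ s : Period T, g ≤ s → pop.Y s ω = pop.Y1 s ω := by
  have hall : ∀ᵐ ω ∂P, ∀ s : Period T, 2 ≤ (s : ℕ) → pop.D (prev s) ω = true →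
      pop.D s ω = true := by
    rw [ae_all_iff]
    intro s
    by_cases hs : 2 ≤ (s : ℕ)
    · filter_upwards [h s hs] with ω hω _ using hω
    · exact ae_of_all _ fun ω hs' => absurd hs' hs
  filter_upwards [hall] with ω hω hG s hs
  -- Induction on the number of periods since first treatment, chaining the one-period implications.
  have key : ∀ n : ℕ, ∀ s : Period T, (s : ℕ) = g + n → pop.D s ω = true := by
    intro n
    induction n with
    | zero =>
      intro s hs
      have : s = g := Subtype.ext (by simpa using hs)
      rw [this]
      exact (pop.treat_of_G hG).1
    | succ n ih =>
      intro s hs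
      have h2 : 2 ≤ (s : ℕ) := by omega
      exact hω s h2 (ih (prev s) (by rw [coe_prev h2]; omega))
  have hs' : (g : ℕ) ≤ s := hs
  have := key (s - g) s (by omega)
  simp [Y, this]

/-- The estimand identifies the group-time average treatment effect. -/
theorem estimand_eq_ATT [IsProbabilityMeasure P] {t : Period T} (hg : 2 ≤ (g : ℕ)) (hgt : g ≤ t)
    (hexist : pop.ExpectationsExist P) (htrend : pop.ParallelTrends P)
    (hirrev : pop.Irreversible P) (hG : 0 < P (pop.evG g))
    (hm : pop.PScoreModel P g Λ Θ π₀) (hmoment : ∀ t : Period T, MemLp (pop.Y t) 2 P) :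
    estimand (pop.law P) g t Λ π₀ = pop.ATT P g t := by
  have hbr := hm.binaryResponse hG hmoment
  obtain ⟨p, hp, hp1, hpS⟩ := hm.exists_pscore_version
  obtain ⟨ρ, hρ, hρB, hρS⟩ := hbr.exists_bounded_extension (hbr.continuousOn_odds hbr.param_mem)
  have hGm := pop.measurable_G_obs g
  have hCm := pop.measurable_C_obs
  have hG01 := fun ω => G_zero_or_one g (pop.obs ω)
  have hps : pop.pscore P g =ᵐ[ProbabilityTheory.cond P (pop.evGC g)] fun ω => p (pop.X ω) := by
    filter_upwards [hm.correct, ProbabilityTheory.cond_absolutelyContinuous.ae_le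
      pop.mem_support_X] with ω h1 h2
    rw [h1, hpS _ h2]
  have hρp : ∀ᵐ ω ∂P, (1 - p (pop.X ω)) * ρ (pop.X ω) = p (pop.X ω) := by
    filter_upwards [pop.mem_support_X (P := P)] with ω hω
    have hne := (sub_pos.2 (hbr.lt_one _ hω π₀ hbr.param_mem)).ne'
    rw [hpS _ hω, ← hρS _ hω, odds, mul_div_cancel₀ _ hne]
  have hYi : ∀ s, Integrable (pop.Y s) P := fun s => (hmoment s).integrable one_le_two
  have hGY : ∀ s, Integrable (fun ω => G g (pop.obs ω) * pop.Y s ω) P := fun s =>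
    integrable_bdd_mul (hYi s) hGm fun ω => norm_G_le g _
  have htreated := hirrev.ae_treated hg
  have hC0 : ∀ s, Integrable (fun ω => C (pop.obs ω) * pop.Y0 s ω) P := fun s => by
    refine (integrable_bdd_mul (hYi s) hCm fun ω => norm_C_le _).congr (ae_of_all _ fun ω => ?_)
    rcases C_zero_or_one (pop.obs ω) with h | h
    · simp only [h, zero_mul]
    · simp only [h, pop.Y_eq_Y0_of_C h]
  have hTE : ∀ s, g ≤ s → Integrable
      (fun ω => G g (pop.obs ω) * (pop.Y1 s ω - pop.Y0 s ω)) P := fun s hs =>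
    (integrable_cond_iff hGm hG01).1 (hexist g s hg hs)
  have hG1 : ∀ s, g ≤ s → (fun ω => G g (pop.obs ω) * pop.Y s ω) =ᵐ[P]
      fun ω => G g (pop.obs ω) * pop.Y1 s ω := fun s hs => by
    filter_upwards [htreated] with ω hω
    rcases hG01 ω with h | h
    · rw [h, zero_mul, zero_mul]
    · rw [hω h s hs]
  have hG0lt : ∀ s, s < g → (fun ω => G g (pop.obs ω) * pop.Y s ω) =
      fun ω => G g (pop.obs ω) * pop.Y0 s ω := fun s hs => by
    ext ω
    rcases hG01 ω with h | h
    · rw [h, zero_mul, zero_mul]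
    · rw [pop.Y_eq_Y0_of_G h hs]
  -- Integrability of Y(0) on group `g` is derived: before `g` it is the observed outcome; from `g`
  -- on it is the observed outcome Y(1) minus the integrable treatment effect.
  have hG0 : ∀ s, Integrable (fun ω => G g (pop.obs ω) * pop.Y0 s ω) P := fun s => by
    rcases lt_or_ge s g with hs | hs
    · rw [← hG0lt s hs]; exact hGY s
    · refine (((hGY s).congr (hG1 s hs)).sub (hTE s hs)).congr (ae_of_all _ fun ω => ?_)
      simp only [Pi.sub_apply]; ring
  have hG0d : ∀ s s', Integrable (fun ω => G g (pop.obs ω) * (pop.Y0 s ω - pop.Y0 s' ω)) P :=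
    fun s s' => ((hG0 s).sub (hG0 s')).congr (ae_of_all _ fun ω => by
      simp only [Pi.sub_apply]; ring)
  have hC0d : ∀ s s', Integrable (fun ω => C (pop.obs ω) * (pop.Y0 s ω - pop.Y0 s' ω)) P :=
    fun s s' => ((hC0 s).sub (hC0 s')).congr (ae_of_all _ fun ω => by
      simp only [Pi.sub_apply]; ring)
  have hC0ρ : ∀ s s', Integrable
      (fun ω => C (pop.obs ω) * (ρ (pop.X ω) * (pop.Y0 s ω - pop.Y0 s' ω))) P := fun s s' => by
    obtain ⟨B, hB⟩ := hρB
    exact (integrable_bdd_mul (hC0d s s') (hρ.comp pop.measurable_X) fun ω => hB _).congr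
      (ae_of_all _ fun ω => mul_left_comm _ _ _)
  have hstep : ∀ s, g ≤ s → ∫ ω, G g (pop.obs ω) * (pop.Y0 s ω - pop.Y0 (prev s) ω) ∂P =
      ∫ ω, C (pop.obs ω) * (ρ (pop.X ω) * (pop.Y0 s ω - pop.Y0 (prev s) ω)) ∂P := fun s hs =>
    integral_G_eq_integral_C hp hp1 hps hρ hρB hρp (hC0d _ _) (htrend g s hg hs)
  -- The baseline `prev g` stays fixed while `s` advances; the case `s = g` is a single application
  -- of parallel trends.
  have htele : ∀ n : ℕ, ∀ s : Period T, (s : ℕ) = g + n →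
      ∫ ω, G g (pop.obs ω) * (pop.Y0 s ω - pop.Y0 (prev g) ω) ∂P =
        ∫ ω, C (pop.obs ω) * (ρ (pop.X ω) * (pop.Y0 s ω - pop.Y0 (prev g) ω)) ∂P := by
    intro n
    induction n with
    | zero =>
      intro s hs
      have : s = g := Subtype.ext (by simpa using hs)
      rw [this]
      exact hstep g le_rfl
    | succ n ih =>
      intro s hs
      have h2 : 2 ≤ (s : ℕ) := by omega
      have hgs : g ≤ s := by
        change (g : ℕ) ≤ s
        omega
      have h3 := congrArg₂ (· + ·) (hstep s hgs) (ih (prev s) (by rw [coe_prev h2]; omega))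
      rw [← integral_add (hG0d _ _) (hG0d _ _), ← integral_add (hC0ρ _ _) (hC0ρ _ _)] at h3
      convert h3 using 2 <;> ext ω <;> ring
  have hgt' : (g : ℕ) ≤ t := hgt
  have hfinal := htele (t - g) t (by omega)
  -- transfer to the population
  have hLD : ∀ ω, longDiff g t (pop.obs ω) = pop.Y t ω - pop.Y (prev g) ω := fun ω => rfl
  have hprev : prev g < g := by
    change ((prev g : Period T) : ℕ) < g
    rw [coe_prev hg]; omega
  have hmap : ∀ f : Obs T k → ℝ, Measurable f →
      ∫ v, f v ∂(pop.law P) = ∫ ω, f (pop.obs ω) ∂P := fun f hf => by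
    rw [law, integral_map pop.measurable_obs.aemeasurable hf.aestronglyMeasurable]
  set EG := ∫ w, G g w ∂(pop.law P) with hEG
  have hEGP : P.real (pop.evG g) = EG := by
    have := integral_cond_mul (P := P) hGm hG01 fun _ => 1
    rw [hEG, hmap _ (measurable_G g)]
    simp only [mul_one] at this
    rw [← this]
    have hpr : IsProbabilityMeasure (ProbabilityTheory.cond P {ω | G g (pop.obs ω) = 1}) :=
      ProbabilityTheory.cond_isProbabilityMeasure hG.ne'
    simp [evG]
  have hGterm : ∫ v, wG (pop.law P) g v * longDiff g t v ∂(pop.law P) =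
      (∫ ω, G g (pop.obs ω) * (pop.Y1 t ω - pop.Y0 (prev g) ω) ∂P) / EG := by
    have h1 : ∀ v, wG (pop.law P) g v * longDiff g t v = G g v * longDiff g t v / EG := fun v => by
      rw [wG]; ring
    simp_rw [h1]
    rw [integral_div, hmap (fun v => G g v * longDiff g t v)
      ((measurable_G g).mul (measurable_longDiff g t))]
    congr 1
    refine integral_congr_ae ?_
    filter_upwards [hG1 t hgt] with ω hω
    have h2 := congrFun (hG0lt _ hprev) ω
    rw [hLD, mul_sub, mul_sub, hω, h2]
  -- The denominator is E[G] by `integral_ctrlWeight`, so this term can be subtracted from the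
  -- treated mean over a common denominator.
  have hCterm : meanC (pop.law P) g t Λ π₀ =
      (∫ ω, C (pop.obs ω) * (ρ (pop.X ω) * (pop.Y0 t ω - pop.Y0 (prev g) ω)) ∂P) / EG := by
    have h1 : ∀ᵐ v ∂(pop.law P), wC (pop.law P) Λ π₀ v * longDiff g t v =
        C v * (ρ (covar v) * longDiff g t v) / EG := by
      filter_upwards [pop.ae_covar_mem_support (P := P)] with v hv
      rw [wC, hbr.integral_ctrlWeight, ctrlWeight_eq, hρS _ hv]
      ring
    rw [meanC, integral_congr_ae h1, integral_div,
      hmap (fun v => C v * (ρ (covar v) * longDiff g t v))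
        (measurable_C.mul ((hρ.comp measurable_covar).mul (measurable_longDiff g t)))]
    congr 1
    refine integral_congr_ae (ae_of_all _ fun ω => ?_)
    rcases C_zero_or_one (pop.obs ω) with h | h
    · simp only [h, zero_mul]
    · simp only [h, hLD, pop.Y_eq_Y0_of_C h, covar_obs]
  have hEG0 : EG ≠ 0 := hbr.G_pos.ne'
  rw [estimand, hGterm, hCterm, ← hfinal, ← sub_div]
  have hdiff : ∫ ω, G g (pop.obs ω) * (pop.Y1 t ω - pop.Y0 (prev g) ω) ∂P
      - ∫ ω, G g (pop.obs ω) * (pop.Y0 t ω - pop.Y0 (prev g) ω) ∂P =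
      ∫ ω, G g (pop.obs ω) * (pop.Y1 t ω - pop.Y0 t ω) ∂P := by
    have h1 : Integrable (fun ω => G g (pop.obs ω) * (pop.Y1 t ω - pop.Y0 (prev g) ω)) P := by
      refine ((hTE t hgt).add (hG0d t (prev g))).congr (ae_of_all _ fun ω => ?_)
      simp only [Pi.add_apply]; ring
    rw [← integral_sub h1 (hG0d _ _)]
    congr 1; ext ω; ring
  rw [hdiff, ← integral_cond_mul hGm hG01, ATT, div_eq_iff hEG0, ← hEGP, mul_comm]
  rfl

end Population

end

end DiD

/-! ### The main theorem. -/

theorem theorem2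
    {T k : ℕ}
    -- the population
    {Ω : Type*} [MeasurableSpace Ω] (P : Measure Ω) [IsProbabilityMeasure P]
    (pop : DiD.Population T k Ω)
    -- the sample
    {Ω' : Type*} [MeasurableSpace Ω'] (Q : Measure Ω') [IsProbabilityMeasure Q]
    (W : ℕ → Ω' → DiD.Obs T k)
    (hindep : iIndepFun W Q)
    (hident : ∀ i, IdentDistrib (W i) pop.obs Q P)
    -- identification
    (hexist : pop.ExpectationsExist P)
    (htrend : pop.ParallelTrends P)
    (hirrev : pop.Irreversible P)
    (hoverlap : pop.Overlap P)
    -- parametric propensity scores and second moments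
    (Λ : DiD.Period T → ℝ → ℝ) (Θ : DiD.Period T → Set (Fin k → ℝ))
    (π₀ : DiD.Period T → Fin k → ℝ)
    (hmodel : ∀ g : DiD.Period T, 2 ≤ (g : ℕ) → pop.PScoreModel P g (Λ g) (Θ g) (π₀ g))
    (hmoment : ∀ t : DiD.Period T, MemLp (pop.Y t) 2 P)
    -- maximum likelihood estimators
    (πhat : DiD.Period T → ℕ → Ω' → Fin k → ℝ)
    (hmeas : ∀ g : DiD.Period T, 2 ≤ (g : ℕ) → ∀ n, AEMeasurable (πhat g n) Q)
    (hmle : ∀ g : DiD.Period T, 2 ≤ (g : ℕ) → ∀ n, ∀ᵐ ω ∂Q,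
      DiD.IsMLE g (Λ g) (Θ g) n (fun i => W i ω) (πhat g n ω)) :
    -- asymptotic linearity, with square-integrable influence function
    (∀ g t : DiD.Period T, 2 ≤ (g : ℕ) → g ≤ t →
      MemLp (DiD.psi (pop.law P) g t (Λ g) (π₀ g)) 2 (pop.law P) ∧
      TendstoInMeasure Q
        (fun (n : ℕ) ω =>
          Real.sqrt n *
              (DiD.attHat g t (Λ g) (πhat g n ω) n (fun i => W i ω) - pop.ATT P g t)
            - 1 / Real.sqrt n *
              ∑ i ∈ Finset.range n, DiD.psi (pop.law P) g t (Λ g) (π₀ g) (W i ω))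
        atTop (fun _ => 0)) ∧
    -- joint asymptotic normality
    TendstoInDistribution
      (fun (n : ℕ) (ω : Ω') => (WithLp.toLp 2 (fun q : DiD.GT T =>
        Real.sqrt n *
          (DiD.attHat q.1.1 q.1.2 (Λ q.1.1) (πhat q.1.1 n ω) n (fun i => W i ω)
            - pop.ATT P q.1.1 q.1.2)) : EuclideanSpace ℝ (DiD.GT T)))
      atTop (id : EuclideanSpace ℝ (DiD.GT T) → EuclideanSpace ℝ (DiD.GT T))
      (fun _ => Q)
      (multivariateGaussian 0 (DiD.Sigma (pop.law P) Λ π₀)) := by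
  have hW : DiD.IIDSample W Q (pop.law P) :=
    ⟨fun i => (hident i).aemeasurable_fst, fun i => (hident i).map_eq, hindep⟩
  have hbr := fun (g : DiD.Period T) (hg : 2 ≤ (g : ℕ)) =>
    (hmodel g hg).binaryResponse (hoverlap g hg).1 hmoment
  have hid := fun (g t : DiD.Period T) (hg : 2 ≤ (g : ℕ)) (hgt : g ≤ t) =>
    DiD.Population.estimand_eq_ATT hg hgt hexist htrend hirrev (hoverlap g hg).1 (hmodel g hg)
      hmoment
  have hlin : ∀ g t : DiD.Period T, 2 ≤ (g : ℕ) → g ≤ t → TendstoInMeasure Q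
        (fun (n : ℕ) ω =>
          Real.sqrt n *
              (DiD.attHat g t (Λ g) (πhat g n ω) n (fun i => W i ω) - pop.ATT P g t)
            - 1 / Real.sqrt n *
              ∑ i ∈ Finset.range n, DiD.psi (pop.law P) g t (Λ g) (π₀ g) (W i ω))
        atTop (fun _ => 0) := fun g t hg hgt => by
    -- The expansion is centred at the weighted-mean estimand; identification turns this centre into
    -- ATT(g,t).
    rw [← hid g t hg hgt]
    exact (hbr g hg).asymptoticLinearity hW t (hmeas g hg) (hmle g hg)
  refine ⟨fun g t hg hgt => ⟨(hbr g hg).memLp_psi t, hlin g t hg hgt⟩, ?_⟩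
  refine DiD.tendstoInDistribution_of_asymptoticallyLinear hW
    (z := fun q : DiD.GT T => DiD.psi (pop.law P) q.1.1 q.1.2 (Λ q.1.1) (π₀ q.1.1))
    (fun q => (hbr _ q.2.1).memLp_psi _) (fun q => (hbr _ q.2.1).integral_psi _)
    (fun q n => ?_) (fun q => hlin _ _ q.2.1 q.2.2)
  exact (((hbr _ q.2.1).aemeasurable_attHat hW q.1.2 (hmeas _ q.2.1 n)
    ((hmle _ q.2.1 n).mono fun ω hω => hω.1) n).sub_const _).const_mul _
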